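/- Let $k$ be a field and let $C$ be a smooth projective geometrically connected curve over $k$. A chain of length $r$ on $C$ is a collection $\mathcal E_\bullet=((\mathcal E_i)_{0\le i\le r},(\phi_i)_{1\le i\le r})$ of vector bundles $\mathcal E_i$ on $C$ and morphisms of $\mathcal O_C$-modules $\phi_i\colon\mathcal E_i\to\mathcal E_{i-1}$; its rank is $(\operatorname{rk}\mathcal E_i)_i$ and its degree is $(\deg\mathcal E_i)_i$. A subchain of $\mathcal E_\bullet$ is a chain $\mathcal E'_\bullet$ of subsheaves $\mathcal E'_i\subseteq\mathcal E_i$ with $\phi_i(\mathcal E'_i)\subseteq\mathcal E'_{i-1}$. For $\alpha=(\alpha_0,\dots,\alpha_r)\in\mathbb R^{r+1}$ the $\alpha$-slope of a nonzero chain is $$\mu_\alpha(\mathcal E_\bullet)=\sum_{i=0}^r\frac{\operatorname{rk}\mathcal E_i}{\sum_j\operatorname{rk}\mathcal E_j}\Big(\frac{\deg\mathcal E_i}{\operatorname{rk}\mathcal E_i}+\alpha_i\Big),$$ where a summand with $\operatorname{rk}\mathcal E_i=0$ is read as $0$. A chain $\mathcal E_\bullet$ is $\alpha$-semistable if $\mu_\alpha(\mathcal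 E'_\bullet)\le\mu_\alpha(\mathcal E_\bullet)$ for every nonzero subchain $\mathcal E'_\bullet\subseteq\mathcal E_\bullet$. A Harder–Narasimhan flag of $\mathcal E_\bullet$ is a flag of subchains $0=\mathcal E^0_\bullet\subset\mathcal E^1_\bullet\subset\dots\subset\mathcal E^h_\bullet=\mathcal E_\bullet$ whose subquotients $\mathcal E^j_\bullet/\mathcal E^{j-1}_\bullet$ are nonzero $\alpha$-semistable chains (of vector bundles) with strictly decreasing $\alpha$-slopes. Fix $n,r\in\mathbb N$, integers $d_r\le d_{r-1}\le\dots\le d_0$ and $\alpha\in\mathbb R^{r+1}$, and suppose that $d_{i-1}-d_i<\alpha_i-\alpha_{i-1}$ for all $1\le i\le r$. Let $\mathcal E_\bullet$ be a chain on $C$ of rank $(n,\dots,n)$ and degree $(d_0,\dots,d_r)$. 1. If $\mathcal E_\bullet$ is $\alpha$-semistable, then all $\phi_i$ are injective, and hence also generically surjective (surjective at the generic point of $C$). 2. If all $\phi_i$ are generically surjective and $\mathcal E^1_\bullet\subset\dots\subset\mathcal E^h_\bullet=\mathcal E_\bullet$ is the Harder–Narasimhan flag of $\mathcal E_\bullet$,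 then for every $j$ there is $m_j\in\mathbb N$ with $\operatorname{rk}(\mathcal E^j_\bullet/\mathcal E^{j-1}_\bullet)=(m_j,\dots,m_j)$. -/

import Mathlib

open CategoryTheory AlgebraicGeometry

universe u

noncomputable section

/-- A smooth projective geometrically connected curve over a field `k`. (For smooth curves over a
field, proper and projective are the same; integrality is automatic, and is part of the usual
definition of a curve.) -/
structure SmoothProjectiveCurve (k : Type u) [Field k] where
  /-- the underlying scheme -/
  X : Scheme.{u}
  /-- the structure morphism -/
  hom : X ⟶ Spec (.of k)
  isIntegral : IsIntegral X
  isProper : IsProper hom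
  smooth : SmoothOfRelativeDimension 1 hom
  geometricallyConnected : GeometricallyConnected hom

namespace SmoothProjectiveCurve

variable {k : Type u} [Field k] (C : SmoothProjectiveCurve k)

instance : IsIntegral C.X := C.isIntegral
instance : IsProper C.hom := C.isProper
instance : SmoothOfRelativeDimension 1 C.hom := C.smooth
instance : GeometricallyConnected C.hom := C.geometricallyConnected
instance : IsLocallyNoetherian C.X := LocallyOfFiniteType.isLocallyNoetherian C.hom

/-- The inclusion of `k` into the residue field of a point. -/
def toResidueField (x : C.X) : k →+* C.X.residueField x :=
  ((Scheme.ΓSpecIso (.of k)).inv ≫ C.hom.appTop ≫ C.X.Γevaluation x).hom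

/-- The degree `[κ(x) : k]` of a (closed) point. -/
def pointDegree (x : C.X) : ℕ :=
  letI : Algebra k (C.X.residueField x) := (C.toResidueField x).toAlgebra
  Module.finrank k (C.X.residueField x)

end SmoothProjectiveCurve

section Frames

variable {X : Scheme.{u}}

/-- Restriction of sections of a sheaf of modules. -/
def resSection (M : X.Modules) {U V : X.Opens} (h : V ≤ U) (s : Γ(M, U)) : Γ(M, V) :=
  M.presheaf.map (homOfLE h).op s

/-- A frame of `M` over `U`: sections `s₁, …, sₙ` over `U` whose restrictions to every open `V ⊆ U`
are a basis of `Γ(M, V)` over `Γ(X, V)`, i.e. which define an isomorphism `𝒪ⁿ ≅ M` over `U`. -/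
structure IsFrame (M : X.Modules) {n : ℕ} (U : X.Opens) (s : Fin n → Γ(M, U)) : Prop where
  linearIndependent : ∀ (V : X.Opens) (h : V ≤ U),
    LinearIndependent Γ(X, V) (fun i => resSection M h (s i))
  span_eq_top : ∀ (V : X.Opens) (h : V ≤ U),
    Submodule.span Γ(X, V) (Set.range fun i => resSection M h (s i)) = ⊤

/-- The basis of `Γ(M, V)` given by a frame over `U ⊇ V`. -/
def IsFrame.basis {M : X.Modules} {n : ℕ} {U : X.Opens} {s : Fin n → Γ(M, U)}
    (hs : IsFrame M U s) {V : X.Opens} (h : V ≤ U) : Module.Basis (Fin n) Γ(X, V) Γ(M, V) :=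
  Module.Basis.mk (hs.linearIndependent V h) (hs.span_eq_top V h).ge

end Frames

/-- A vector bundle on the curve `C`: a sheaf of `𝒪`-modules which is locally free of finite
rank. As `C` is connected and nonempty the rank is a constant, determined by the sheaf. -/
structure CurveBundle {k : Type u} [Field k] (C : SmoothProjectiveCurve k) where
  /-- the sheaf of `𝒪`-modules -/
  sheaf : C.X.Modules
  /-- the rank -/
  rank : ℕ
  exists_frame : ∀ x : C.X, ∃ U : C.X.Opens, x ∈ U ∧
    ∃ s : Fin rank → Γ(sheaf, U), IsFrame sheaf U s

namespace CurveBundle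

variable {k : Type u} [Field k] {C : SmoothProjectiveCurve k} (E : CurveBundle C)

/-- An open neighbourhood of `x` on which `E` has a frame. -/
def nhd (x : C.X) : C.X.Opens := (E.exists_frame x).choose

lemma mem_nhd (x : C.X) : x ∈ E.nhd x := (E.exists_frame x).choose_spec.1

/-- A frame of `E` in a neighbourhood of `x`. -/
def frame (x : C.X) : Fin E.rank → Γ(E.sheaf, E.nhd x) :=
  (E.exists_frame x).choose_spec.2.choose

lemma isFrame_frame (x : C.X) : IsFrame E.sheaf (E.nhd x) (E.frame x) :=
  (E.exists_frame x).choose_spec.2.choose_spec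

lemma nonempty_inf (x : C.X) :
    Nonempty (E.nhd (genericPoint C.X) ⊓ E.nhd x : C.X.Opens).toScheme :=
  ⟨⟨genericPoint C.X, E.mem_nhd _,
    ((genericPoint_spec C.X).mem_open_set_iff (E.nhd x).isOpen).mpr
      ⟨x, Set.mem_univ _, E.mem_nhd x⟩⟩⟩

/-- Let `s` be the frame of `E` chosen at the generic point and `t` the frame chosen at `x`.
This is the rational function `g` with `s₁ ∧ ⋯ ∧ sₙ = g • t₁ ∧ ⋯ ∧ tₙ`. -/
def detTransition (x : C.X) : C.X.functionField :=
  haveI := E.nonempty_inf x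
  C.X.germToFunctionField (E.nhd (genericPoint C.X) ⊓ E.nhd x)
    (((E.isFrame_frame x).basis inf_le_right).det
      (fun i => resSection E.sheaf inf_le_left (E.frame (genericPoint C.X) i)))

/-- The degree of a vector bundle: the degree `∑ₓ ordₓ(σ) [κ(x) : k]` of the divisor of a nonzero
rational section `σ = s₁ ∧ ⋯ ∧ sₙ` of its determinant line bundle. The sum is over the closed
points, `Scheme.ord` being zero at the generic point. -/
def degree : ℤ :=
  ∑ᶠ x : C.X, C.X.ord (E.detTransition x) x * (C.pointDegree x : ℤ)

end CurveBundle

/-- A morphism of sheaves of modules on an irreducible scheme is generically surjective if it is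
surjective on stalks at the generic point. -/
def GenericallySurjective {X : Scheme.{u}} [IrreducibleSpace X] {M N : X.Modules}
    (f : M ⟶ N) : Prop :=
  Function.Surjective
    ((TopCat.Presheaf.stalkFunctor Ab (genericPoint X)).map (Scheme.Modules.Hom.mapPresheaf f))

/-- A chain `E_r ⟶ ⋯ ⟶ E_1 ⟶ E_0` of vector bundles on `C`. -/
structure BundleChain {k : Type u} [Field k] (C : SmoothProjectiveCurve k) (r : ℕ) where
  /-- the vector bundles `E_0, …, E_r` -/
  E : Fin (r + 1) → CurveBundle C
  /-- `φ i` is the map `φ_{i+1} : E_{i+1} ⟶ E_i` -/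
  φ : ∀ i : Fin r, (E i.succ).sheaf ⟶ (E i.castSucc).sheaf

namespace BundleChain

variable {k : Type u} [Field k] {C : SmoothProjectiveCurve k} {r : ℕ}

/-- Morphisms of chains. -/
structure Hom (E F : BundleChain C r) where
  app : ∀ i, (E.E i).sheaf ⟶ (F.E i).sheaf
  comm : ∀ i : Fin r, E.φ i ≫ app i.castSucc = app i.succ ≫ F.φ i

/-- `|rk E| = ∑ᵢ rk Eᵢ`. -/
def totalRank (E : BundleChain C r) : ℕ := ∑ i, (E.E i).rank

/-- The `α`-slope `∑ᵢ (rk Eᵢ / |rk E|) (deg Eᵢ / rk Eᵢ + αᵢ)`; a summand with `rk Eᵢ = 0` is `0`. -/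
def slope (α : Fin (r + 1) → ℝ) (E : BundleChain C r) : ℝ :=
  ∑ i, ((E.E i).rank : ℝ) / (E.totalRank : ℝ) *
    (((E.E i).degree : ℝ) / ((E.E i).rank : ℝ) + α i)

/-- `E` is `α`-semistable if `μ(E') ≤ μ(E)` for all nonzero subchains `E' ⊆ E`, a subchain being
a chain with a morphism to `E` all of whose components are injective. (For `E' = E` the inequality
is an equality, so only proper subchains matter.) -/
def IsSemistable (α : Fin (r + 1) → ℝ) (E : BundleChain C r) : Prop :=
  ∀ (E' : BundleChain C r) (ι : Hom E' E), (∀ i, Mono (ι.app i)) → E'.totalRank ≠ 0 →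
    slope α E' ≤ slope α E

/-- A Harder–Narasimhan flag `0 = F_0 ⊂ F_1 ⊂ ⋯ ⊂ F_h = E` of a chain: the subquotients
`G_j = F_{j+1} / F_j` are nonzero `α`-semistable chains of strictly decreasing slopes. -/
structure HNFlag (α : Fin (r + 1) → ℝ) (E : BundleChain C r) where
  /-- the length of the flag -/
  h : ℕ
  /-- the steps of the flag -/
  F : Fin (h + 1) → BundleChain C r
  /-- the subquotients -/
  G : Fin h → BundleChain C r
  /-- the inclusion of a step in the next one -/
  incl : ∀ j : Fin h, Hom (F j.castSucc) (F j.succ)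
  /-- the projection to the subquotient -/
  proj : ∀ j : Fin h, Hom (F j.succ) (G j)
  shortExact : ∀ (j : Fin h) (i : Fin (r + 1)),
    ∃ w : (incl j).app i ≫ (proj j).app i = 0, (ShortComplex.mk _ _ w).ShortExact
  bot_eq : (F 0).totalRank = 0
  top_eq : F (Fin.last h) = E
  ne_zero : ∀ j, (G j).totalRank ≠ 0
  semistable : ∀ j, IsSemistable α (G j)
  slope_strictAnti : StrictAnti fun j => slope α (G j)

end BundleChain

end

/-! Fix a map `φ i` of a semistable chain of slope μ. Its kernel, placed alone at the source vertex,
is a subchain; so is the whole chain with the target bundle replaced by the image of `φ i`. Add the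
two semistability inequalities and use additivity of rank and degree along 0 → ker → E_i → im → 0.
With a the rank of the kernel and b the corank of the image, this gives deg E_i - deg E_{i-1} + a
α_i - b α_{i-1} ≤ (rk E_i - rk E_{i-1}) μ, which is `BundleChain.IsSemistable.exists_defect`. If the
ranks agree then a = b, so a (α_i - α_{i-1}) ≤ d_{i-1} - d_i, which is nonnegative and less than α_i
- α_{i-1}; hence a = 0. This is the first claim, and equal ranks turn generic injectivity into
generic surjectivity.

For the second claim, apply the same inequality to every Harder–Narasimhan subquotient and sum.
Degrees add up to those of E, and the total of the a's equals the total of the b's. On the right,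
the partial sums of the rank differences are nonpositive, because the maps stay generically
injective on each step of the flag, and the last partial sum is zero; as the slopes decrease,
summation by parts makes the right side nonpositive (`HNFlag.sum_rank_sub_mul_slope_le`). The
numerical argument above then makes all a's and b's vanish, so each subquotient has equal ranks at
neighbouring vertices.

Most of the work lies in the additivity of the degree (`CurveBundle.degree_eq_add`), the degree
being computed from chosen frames. For bases adapted to an exact sequence determinants multiply, so
the divisors agree up to that of one rational function, and the claim reduces to the product
formula. That formula is proved classically: the degree of the zeros of g is at most the number of
elements independent over k(g), which is at most the degree of the poles of g; then exchange g and
its inverse. Kernels and images are again bundles because the local rings of the curve are principal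
ideal domains. -/

/-! ### Discrete places of a function field and dimension counts. -/

section Places

open WithZero Polynomial

variable {k K S : Type*} [Field k] [Field K] [Algebra k K]

/-- The elements `f` with `v f ≤ exp n`, for a valuation `v` of `K` which is at most `1` on `k`. -/
def valFilt (v : Valuation K ℤᵐ⁰) (hv : ∀ c : k, v (algebraMap k K c) ≤ 1) (n : ℤ) :
    Submodule k K where
  carrier := {f | v f ≤ exp n}
  add_mem' {a b} ha hb := (v.map_add a b).trans (max_le ha hb)
  zero_mem' := by simp
  smul_mem' c f hf := by
    simp only [Set.mem_ofPred_eq, Algebra.smul_def, map_mul] at hf ⊢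
    exact (mul_le_mul' (hv c) hf).trans (one_mul _).le

lemma mem_valFilt {v : Valuation K ℤᵐ⁰} {hv : ∀ c : k, v (algebraMap k K c) ≤ 1} {n : ℤ} {f : K} :
    f ∈ valFilt v hv n ↔ v f ≤ exp n := Iff.rfl

lemma valFilt_mono (v : Valuation K ℤᵐ⁰) (hv : ∀ c : k, v (algebraMap k K c) ≤ 1) :
    Monotone (valFilt v hv) := fun _ _ h _ hf => le_trans hf (exp_le_exp.mpr h)

/-- The relative quotient `B / (A ∩ B)` of two subspaces. -/
def relQuot {M : Type*} [AddCommGroup M] [Module k M] (A B : Submodule k M) :=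
  ↥B ⧸ A.submoduleOf B

instance {M : Type*} [AddCommGroup M] [Module k M] (A B : Submodule k M) :
    AddCommGroup (relQuot A B) :=
  inferInstanceAs (AddCommGroup (↥B ⧸ A.submoduleOf B))

instance {M : Type*} [AddCommGroup M] [Module k M] (A B : Submodule k M) :
    Module k (relQuot A B) :=
  inferInstanceAs (Module k (↥B ⧸ A.submoduleOf B))

/-- The quotient map to `relQuot A B`. -/
def relQuot.mk {M : Type*} [AddCommGroup M] [Module k M] (A B : Submodule k M) :
    ↥B →ₗ[k] relQuot A B := (A.submoduleOf B).mkQ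

lemma relQuot.mk_eq_zero {M : Type*} [AddCommGroup M] [Module k M] {A B : Submodule k M} {b : ↥B} :
    relQuot.mk A B b = 0 ↔ b.1 ∈ A := Submodule.Quotient.mk_eq_zero _

lemma relQuot.mk_surjective {M : Type*} [AddCommGroup M] [Module k M] (A B : Submodule k M) :
    Function.Surjective (relQuot.mk A B) := Submodule.mkQ_surjective _

lemma length_relQuot_add {M : Type*} [AddCommGroup M] [Module k M] {A B D : Submodule k M}
    (hAB : A ≤ B) (hBD : B ≤ D) :
    Module.length k (relQuot A D) = Module.length k (relQuot A B) + Module.length k (relQuot B D) := by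
  let f : relQuot A B →ₗ[k] relQuot A D :=
    Submodule.liftQ _ (relQuot.mk A D ∘ₗ Submodule.inclusion hBD)
      (fun x hx => relQuot.mk_eq_zero.mpr hx)
  let g : relQuot A D →ₗ[k] relQuot B D :=
    Submodule.liftQ _ (relQuot.mk B D) (fun x hx => relQuot.mk_eq_zero.mpr (hAB hx))
  have hf : ∀ m, f (relQuot.mk A B m) = relQuot.mk A D ⟨m.1, hBD m.2⟩ := fun m => rfl
  have hg : ∀ m, g (relQuot.mk A D m) = relQuot.mk B D m := fun m => rfl
  refine Module.length_eq_add_of_exact f g ?_ ?_ ?_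
  · rw [← LinearMap.ker_eq_bot, LinearMap.ker_eq_bot']
    intro m hm
    obtain ⟨m, rfl⟩ := relQuot.mk_surjective _ _ m
    rw [hf, relQuot.mk_eq_zero] at hm
    exact relQuot.mk_eq_zero.mpr hm
  · intro m
    obtain ⟨m, rfl⟩ := relQuot.mk_surjective _ _ m
    exact ⟨relQuot.mk A D m, rfl⟩
  · intro m
    obtain ⟨m, rfl⟩ := relQuot.mk_surjective _ _ m
    rw [hg, relQuot.mk_eq_zero]
    constructor
    · intro h
      exact ⟨relQuot.mk A B ⟨m.1, h⟩, rfl⟩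
    · rintro ⟨m', hm'⟩
      obtain ⟨m', rfl⟩ := relQuot.mk_surjective _ _ m'
      rw [hf, ← sub_eq_zero, ← map_sub, relQuot.mk_eq_zero] at hm'
      have := B.sub_mem m'.2 (hAB hm')
      simpa using this

lemma length_le_ker_add {M P : Type*} [AddCommGroup M] [Module k M] [AddCommGroup P] [Module k P]
    (g : M →ₗ[k] P) :
    Module.length k M ≤ Module.length k (LinearMap.ker g) + Module.length k P := by
  rw [Module.length_eq_add_of_exact (LinearMap.ker g).subtype g.rangeRestrict
    (Submodule.subtype_injective _) g.surjective_rangeRestrict (fun x => by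
      rw [← Subtype.coe_inj, ZeroMemClass.coe_zero]
      exact ⟨fun hx => ⟨⟨x, hx⟩, rfl⟩, fun ⟨a, ha⟩ => ha ▸ a.2⟩)]
  gcongr
  exact Module.length_le_of_injective _ (Submodule.subtype_injective _)

/-- A family of discrete valuations of `K / k` with residue fields of degrees `d`, with the
finiteness properties of the closed points of a proper curve. -/
structure IsProperPlaceFamily (k : Type*) {K S : Type*} [Field k] [Field K] [Algebra k K]
    (v : S → Valuation K ℤᵐ⁰) (d : S → ℕ) : Prop where
  const : ∀ x (c : k), v x (algebraMap k K c) ≤ 1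
  uniformizer : ∀ x, ∃ π : K, v x π = exp (-1)
  residue : ∀ x, Module.length k
    (relQuot (valFilt (v x) (const x) (-1)) (valFilt (v x) (const x) 0)) = d x
  finite : ∀ f : K, f ≠ 0 → {x | v x f ≠ 1}.Finite
  incomparable : ∀ x y, x ≠ y → ∃ f : K, v x f ≤ 1 ∧ 1 < v y f
  global : Module.length k (⨅ x, valFilt (v x) (const x) 0 : Submodule k K) ≠ ⊤

namespace IsProperPlaceFamily

variable {v : S → Valuation K ℤᵐ⁰} {d : S → ℕ} (h : IsProperPlaceFamily k v d)

/-- Multiplication by the n-th power of a uniformizer carries the filtration steps n and n - 1 onto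
the steps 0 and -1, where the quotient is the residue field. -/
lemma length_shift (x : S) (n : ℤ) : Module.length k
    (relQuot (valFilt (v x) (h.const x) (n - 1)) (valFilt (v x) (h.const x) n)) = d x := by
  rw [← h.residue x]
  obtain ⟨π, hπ⟩ := h.uniformizer x
  have hπ0 : π ≠ 0 := by
    rintro rfl
    rw [map_zero] at hπ
    exact exp_ne_zero hπ.symm
  have key : ∀ m (f : K), v x (π ^ n * f) ≤ exp m ↔ v x f ≤ exp (n + m) := by
    intro m f
    rw [map_mul, map_zpow₀, hπ, ← exp_zsmul, smul_eq_mul, mul_neg, mul_one, exp_neg,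
      inv_mul_le_iff₀ exp_pos, exp_add]
  let e : valFilt (v x) (h.const x) n ≃ₗ[k] valFilt (v x) (h.const x) 0 :=
    { toFun := fun f => ⟨π ^ n * f.1, (key 0 f).mpr (by rw [add_zero]; exact f.2)⟩
      invFun := fun f => ⟨π ^ (-n) * f.1, by
        have := (key 0 (π ^ (-n) * f.1)).mp (by
          rw [← mul_assoc, ← zpow_add₀ hπ0, add_neg_cancel, zpow_zero, one_mul]; exact f.2)
        rwa [add_zero] at this⟩
      map_add' := fun a b => by ext; simp [mul_add]
      map_smul' := fun c a => by ext; simp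
      left_inv := fun a => Subtype.ext <| by
        change π ^ (-n) * (π ^ n * a.1) = a.1
        rw [← mul_assoc, ← zpow_add₀ hπ0, neg_add_cancel, zpow_zero, one_mul]
      right_inv := fun a => Subtype.ext <| by
        change π ^ n * (π ^ (-n) * a.1) = a.1
        rw [← mul_assoc, ← zpow_add₀ hπ0, add_neg_cancel, zpow_zero, one_mul] }
  refine (Submodule.Quotient.equiv _ _ e ?_).length_eq
  ext f
  rw [Submodule.mem_map_equiv]
  change v x (π ^ (-n) * f.1) ≤ exp (n - 1) ↔ v x f.1 ≤ exp (-1)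
  rw [sub_eq_add_neg, ← key (-1), ← mul_assoc, ← zpow_add₀ hπ0, add_neg_cancel, zpow_zero, one_mul]

lemma length_filt (x : S) (a : ℤ) (n : ℕ) : Module.length k
    (relQuot (valFilt (v x) (h.const x) a) (valFilt (v x) (h.const x) (a + n))) = (n * d x : ℕ) := by
  induction n with
  | zero =>
    simp only [Nat.cast_zero, zero_mul]
    rw [Module.length_eq_zero_iff]
    refine ⟨fun a b => ?_⟩
    obtain ⟨a, rfl⟩ := relQuot.mk_surjective _ _ a
    obtain ⟨b, rfl⟩ := relQuot.mk_surjective _ _ b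
    rw [← sub_eq_zero, ← map_sub, relQuot.mk_eq_zero]
    simpa using (a - b).2
  | succ n ih =>
    rw [length_relQuot_add (B := valFilt (v x) (h.const x) (a + n)) (valFilt_mono _ _ (by simp))
      (valFilt_mono _ _ (by simp)), ih]
    have := h.length_shift x (a + (n + 1 : ℕ))
    rw [show a + ((n + 1 : ℕ) : ℤ) - 1 = a + n by push_cast; ring] at this
    rw [this]
    push_cast
    ring

/-- Elements whose poles are bounded by the divisor `n`. -/
def riemannRoch (n : S → ℕ) : Submodule k K := ⨅ x, valFilt (v x) (h.const x) (n x)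

lemma mem_riemannRoch {n : S → ℕ} {f : K} : f ∈ h.riemannRoch n ↔ ∀ x, v x f ≤ exp (n x : ℤ) := by
  simp [riemannRoch, Submodule.mem_iInf, mem_valFilt]

/-- Taking polar parts at the places of `s` has kernel inside the everywhere regular functions, and
the polar parts at x form a space of dimension n x times d x. This is the easy half of Riemann–Roch.
-/
lemma length_riemannRoch_le (n : S → ℕ) (s : Finset S) (hs : ∀ x ∉ s, n x = 0) :
    Module.length k (h.riemannRoch n) ≤
      Module.length k (h.riemannRoch fun _ => 0) + (∑ x ∈ s, n x * d x : ℕ) := by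
  let g : h.riemannRoch n →ₗ[k] Π x : s,
      relQuot (valFilt (v x) (h.const x) 0) (valFilt (v x) (h.const x) (0 + n x)) := LinearMap.pi fun x =>
    relQuot.mk _ _ ∘ₗ Submodule.inclusion (by
      intro f hf
      simpa [mem_valFilt] using h.mem_riemannRoch.mp hf x)
  have hker : (LinearMap.ker g).map (h.riemannRoch n).subtype ≤ h.riemannRoch fun _ => 0 := by
    rintro _ ⟨f, hf, rfl⟩
    rw [mem_riemannRoch]
    intro x
    by_cases hx : x ∈ s
    · have := congr_fun (LinearMap.mem_ker.mp hf) ⟨x, hx⟩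
      exact relQuot.mk_eq_zero.mp this
    · simpa [hs x hx] using h.mem_riemannRoch.mp f.2 x
  refine (length_le_ker_add (P := Π x : s,
    relQuot (valFilt (v x) (h.const x) 0) (valFilt (v x) (h.const x) (0 + n x))) g).trans (add_le_add ?_ ?_)
  · exact Module.length_le_of_injective
      (LinearMap.restrict (h.riemannRoch n).subtype fun f hf => hker ⟨f, hf, rfl⟩)
      fun a b hab => Subtype.ext (Subtype.ext (congr_arg Subtype.val hab :))
  · rw [Module.length_pi_of_fintype, ← Finset.sum_coe_sort s (fun x => n x * d x), Nat.cast_sum]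
    refine Finset.sum_le_sum fun x _ => ?_
    rw [h.length_filt]

/-- Multiplying by a polynomial in `g` removes the poles of `u` at the places where `g` is regular. -/
lemma exists_aeval_mul_regular {v : S → Valuation K ℤᵐ⁰} {d : S → ℕ}
    (h : IsProperPlaceFamily k v d) (g u : K) :
    ∃ p : k[X], p ≠ 0 ∧ ∀ x, v x g ≤ 1 → v x (aeval g p * u) ≤ 1 := by
  have hreg : ∀ x, v x g ≤ 1 → ∀ p : k[X], v x (aeval g p) ≤ 1 := by
    intro x hx p
    induction p using Polynomial.induction_on' with
    | add p q hp hq =>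
      rw [map_add]
      exact (v x).map_add_le hp hq
    | monomial n a =>
      rw [aeval_monomial, map_mul, map_pow]
      exact mul_le_one' (h.const x a) (pow_le_one' hx n)
  -- The residue field is finite-dimensional and `k[X]` is not, so some nonzero polynomial in g
  -- vanishes at x.
  have hvan : ∀ x, v x g ≤ 1 → ∃ p : k[X], p ≠ 0 ∧ v x (aeval g p) ≤ exp (-1) := by
    intro x hx
    let φ : k[X] →ₗ[k] relQuot (valFilt (v x) (h.const x) (-1)) (valFilt (v x) (h.const x) 0) :=
      relQuot.mk _ _ ∘ₗ LinearMap.codRestrict _ (aeval g).toLinearMap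
        (fun p => by simpa [mem_valFilt] using hreg x hx p)
    have hni : ¬ Function.Injective φ := by
      intro hinj
      have h1 := Module.length_le_of_injective φ hinj
      rw [h.residue x] at h1
      have h2 : Module.length k k[X] ≠ ⊤ := ne_top_of_le_ne_top (ENat.natCast_ne_top _) h1
      rw [Module.length_ne_top_iff, isFiniteLength_iff_isNoetherian_isArtinian] at h2
      have := h2.1
      exact Polynomial.not_finite (inferInstance : Module.Finite k k[X])
    rw [← LinearMap.ker_eq_bot, Submodule.eq_bot_iff] at hni
    push Not at hni
    obtain ⟨p, hp, hp0⟩ := hni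
    exact ⟨p, hp0, relQuot.mk_eq_zero.mp hp⟩
  classical
  by_cases hu : u = 0
  · exact ⟨1, one_ne_zero, by simp [hu]⟩
  choose! q hq0 hq using hvan
  have hfin := h.finite u hu
  let s := hfin.toFinset.filter (fun x => v x g ≤ 1)
  -- The exponent is the pole order of u at x, truncated to 0 when u has no pole there.
  refine ⟨∏ x ∈ s, q x ^ (log (v x u)).toNat, ?_, fun y hy => ?_⟩
  · refine Finset.prod_ne_zero_iff.mpr fun x hx => pow_ne_zero _ (hq0 x (Finset.mem_filter.mp hx).2)
  · rw [map_prod, map_mul, map_prod]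
    by_cases hys : y ∈ s
    · rw [← Finset.mul_prod_erase _ _ hys, mul_right_comm]
      refine mul_le_one' ?_ (Finset.prod_le_one' fun x _ => hreg y hy _)
      rw [map_pow, map_pow]
      have hvu : v y u ≠ 0 := by simpa using hu
      calc v y (aeval g (q y)) ^ (log (v y u)).toNat * v y u
          ≤ exp (-1) ^ (log (v y u)).toNat * exp ((log (v y u)).toNat : ℤ) := by
            refine mul_le_mul' (pow_le_pow_left' (hq y hy) _) ?_
            rw [← log_le_iff_le_exp hvu]
            exact Int.self_le_toNat _
        _ = 1 := by rw [← exp_nsmul, ← exp_add]; simp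
    · have : v y u = 1 := by
        by_contra hne
        exact hys (Finset.mem_filter.mpr ⟨hfin.mem_toFinset.mpr hne, hy⟩)
      rw [this, mul_one]
      exact Finset.prod_le_one' fun x _ => hreg y hy _

end IsProperPlaceFamily

end Places

/-! ### The product formula. -/

section ProductFormula

open WithZero Polynomial

variable {k K S : Type*} [Field k] [Field K] [Algebra k K]

/-- The real absolute value of a discrete valuation. -/
noncomputable def intAbv (v : Valuation K ℤᵐ⁰) : AbsoluteValue K ℝ where
  toFun f := WithZeroMulInt.toNNReal (e := 2) two_ne_zero (v f)
  map_mul' := by simp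
  nonneg' := by simp
  eq_zero' f := by
    rw [NNReal.coe_eq_zero, map_eq_zero, map_eq_zero]
  add_le' a b := by
    have hm := (WithZeroMulInt.toNNReal_strictMono (e := 2) one_lt_two).monotone
    have := hm (v.map_add a b)
    rw [hm.map_max] at this
    norm_cast
    exact this.trans (max_le_add_of_nonneg (by simp) (by simp))

lemma one_lt_intAbv (v : Valuation K ℤᵐ⁰) (f : K) : 1 < intAbv v f ↔ 1 < v f := by
  change 1 < ((WithZeroMulInt.toNNReal (e := 2) two_ne_zero (v f) : NNReal) : ℝ) ↔ _
  have hm := WithZeroMulInt.toNNReal_strictMono (e := 2) one_lt_two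
  have := hm.lt_iff_lt (a := 1) (b := v f)
  rw [map_one] at this
  rw [← this]
  norm_cast

lemma intAbv_lt_one (v : Valuation K ℤᵐ⁰) (f : K) : intAbv v f < 1 ↔ v f < 1 := by
  change ((WithZeroMulInt.toNNReal (e := 2) two_ne_zero (v f) : NNReal) : ℝ) < 1 ↔ _
  have hm := WithZeroMulInt.toNNReal_strictMono (e := 2) one_lt_two
  have := hm.lt_iff_lt (b := 1) (a := v f)
  rw [map_one] at this
  rw [← this]
  norm_cast

lemma WithZero.pow_le_exp_neg {a : ℤᵐ⁰} (ha : a < 1) (n : ℕ) : a ^ n ≤ exp (-(n : ℤ)) := by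
  have h1 : a ≤ exp (-1) := by
    rcases eq_or_ne a 0 with rfl | h0
    · simp
    rw [← log_le_iff_le_exp h0]
    rw [← exp_zero, ← log_lt_iff_lt_exp h0] at ha
    omega
  refine (pow_le_pow_left' h1 n).trans ?_
  rw [← exp_nsmul]
  simp

namespace IsProperPlaceFamily

variable {v : S → Valuation K ℤᵐ⁰} {d : S → ℕ}

/-- The number of elements of `K` that are linearly independent over `k(g)` is at most the degree
of the divisor of poles of `g`. -/
lemma card_le_degree_poles (h : IsProperPlaceFamily k v d)
    (g : K) (s : Finset S) (hs : ∀ x ∉ s, v x g ≤ 1) {N : ℕ}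
    (u : Fin N → K) (hu : ∀ P : Fin N → k[X], ∑ i, aeval g (P i) * u i = 0 → P = 0) :
    N ≤ ∑ x ∈ s, (log (v x g)).toNat * d x := by
  classical
  rcases Nat.eq_zero_or_pos N with rfl | hN
  · simp
  have hg0 : g ≠ 0 := by
    rintro rfl
    -- If g were 0, the polynomial X would give a nontrivial relation.
    have := congr_fun (hu (fun _ => X) (by simp)) ⟨0, hN⟩
    exact X_ne_zero this
  set n : S → ℕ := fun x => (log (v x g)).toNat with hn
  have hvg : ∀ x, v x g ≠ 0 := fun x => by simpa using hg0
  have hn_le : ∀ x, v x g ≤ exp (n x : ℤ) := fun x => by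
    rw [← log_le_iff_le_exp (hvg x)]
    exact Int.self_le_toNat _
  have hn0 : ∀ x, v x g ≤ 1 → n x = 0 := fun x hx => by
    rw [hn, Int.toNat_eq_zero, log_le_iff_le_exp (hvg x)]
    simpa using hx
  have hn1 : ∀ x, ¬ v x g ≤ 1 → 1 ≤ n x := fun x hx => by
    by_contra hlt
    have h0 : n x = 0 := by omega
    rw [hn, Int.toNat_eq_zero, log_le_iff_le_exp (hvg x)] at h0
    exact hx (by simpa using h0)
  choose p hp0 hp using fun i => h.exists_aeval_mul_regular g (u i)
  set w : Fin N → K := fun i => aeval g (p i) * u i with hw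
  have hwind : ∀ P : Fin N → k[X], ∑ i, aeval g (P i) * w i = 0 → P = 0 := by
    intro P hP
    have := hu (fun i => P i * p i) (by simpa [hw, mul_assoc] using hP)
    ext1 i
    exact (mul_eq_zero.mp (congr_fun this i)).resolve_right (hp0 i)
  obtain ⟨l, hl⟩ : ∃ l : ℕ, ∀ x i, v x (w i) ≤ exp ((l * n x : ℕ) : ℤ) := by
    -- The `w i` have poles only at poles of g, where `n x` is at least 1, so a crude total of all
    -- pole orders serves as the multiple l.
    refine ⟨∑ x ∈ s, ∑ i, (log (v x (w i))).toNat, fun x i => ?_⟩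
    by_cases hx : v x g ≤ 1
    · exact (hp i x hx).trans (by simp [hn0 x hx])
    · have hxs : x ∈ s := by
        by_contra hc
        exact hx (hs x hc)
      by_cases hwi : w i = 0
      · simp [hwi]
      rw [← log_le_iff_le_exp (by simpa using hwi)]
      refine (Int.self_le_toNat _).trans ?_
      norm_cast
      calc (log (v x (w i))).toNat ≤ ∑ j, (log (v x (w j))).toNat :=
            Finset.single_le_sum (f := fun j => (log (v x (w j))).toNat)
              (fun _ _ => Nat.zero_le _) (Finset.mem_univ i)
        _ ≤ ∑ y ∈ s, ∑ j, (log (v y (w j))).toNat :=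
            Finset.single_le_sum (f := fun y => ∑ j, (log (v y (w j))).toNat)
              (fun _ _ => Nat.zero_le _) hxs
        _ ≤ _ := Nat.le_mul_of_pos_right _ (hn1 x hx)
  have hglob : Module.length k (h.riemannRoch fun _ => 0) ≠ ⊤ := by
    have : (h.riemannRoch fun _ => 0) = ⨅ x, valFilt (v x) (h.const x) 0 := by
      simp [riemannRoch]
    rw [this]
    exact h.global
  obtain ⟨c, hc⟩ := ENat.ne_top_iff_exists.mp hglob
  set D := ∑ x ∈ s, n x * d x with hD
  -- The products g^j w_i with j < m are N m independent functions whose poles are bounded by l + m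
  -- times the polar divisor of g. Comparing growth in m will give N ≤ D.
  have hbound : ∀ m : ℕ, N * m ≤ c + (l + m) * D := by
    intro m
    have h1 := h.length_riemannRoch_le (fun x => (l + m) * n x) s
      (fun x hx => by rw [hn0 x (hs x hx), mul_zero])
    let φ : (Fin N → degreeLT k m) →ₗ[k] h.riemannRoch (fun x => (l + m) * n x) :=
      LinearMap.codRestrict _ (∑ i, (LinearMap.mulRight k (w i)) ∘ₗ (aeval g).toLinearMap ∘ₗ
        (degreeLT k m).subtype ∘ₗ LinearMap.proj i) (by
        intro P
        rw [LinearMap.sum_apply]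
        refine Submodule.sum_mem _ fun i _ => ?_
        simp only [LinearMap.comp_apply, LinearMap.proj_apply, Submodule.subtype_apply,
          AlgHom.toLinearMap_apply, LinearMap.mulRight_apply]
        rw [aeval_eq_sum_range, Finset.sum_mul]
        refine Submodule.sum_mem _ fun j hj => ?_
        rw [smul_mul_assoc]
        by_cases hPi : (P i : k[X]) = 0
        · simp [hPi]
        refine Submodule.smul_mem _ _ (h.mem_riemannRoch.mpr fun x => ?_)
        have hjm : j ≤ m := by
          have := mem_degreeLT.mp (P i).2
          rw [degree_eq_natDegree hPi] at this
          have : (P i : k[X]).natDegree < m := by exact_mod_cast this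
          have := Finset.mem_range.mp hj
          omega
        rw [map_mul, map_pow]
        calc v x g ^ j * v x (w i) ≤ exp (n x : ℤ) ^ j * exp ((l * n x : ℕ) : ℤ) :=
              mul_le_mul' (pow_le_pow_left' (hn_le x) _) (hl x i)
          _ = exp ((j * n x + l * n x : ℕ) : ℤ) := by
              rw [← exp_nsmul, ← exp_add]; push_cast; simp
          _ ≤ _ := by
              rw [exp_le_exp]
              norm_cast
              nlinarith)
    have hφ : Function.Injective φ := by
      rw [← LinearMap.ker_eq_bot, LinearMap.ker_eq_bot']
      intro P hP
      have h2 : ∑ i, aeval g (P i : k[X]) * w i = 0 := by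
        have := congr_arg Subtype.val hP
        simpa [φ, LinearMap.sum_apply] using this
      have := hwind (fun i => P i) h2
      ext1 i
      exact Subtype.ext (congr_fun this i)
    have h2 := (Module.length_le_of_injective φ hφ).trans h1
    have h3 : Module.length k (Fin N → degreeLT k m) = (N * m : ℕ) := by
      rw [Module.length_pi_of_fintype, (degreeLTEquiv k m).length_eq,
        Module.length_pi_of_fintype]
      simp
    rw [h3, ← hc] at h2
    have h4 : N * m ≤ c + ∑ x ∈ s, (l + m) * n x * d x := by exact_mod_cast h2
    rw [hD, Finset.mul_sum]
    simpa [mul_assoc] using h4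
  by_contra! hlt
  -- If N ≥ D + 1, the bound forces m ≤ c + l D; this m is the first to violate it.
  have h1 := hbound (c + l * D + 1)
  have h2 := Nat.mul_le_mul_right (c + l * D + 1) (Nat.succ_le_of_lt hlt)
  generalize hM : c + l * D + 1 = M at h1 h2
  have h3 := h2.trans h1
  rw [Nat.succ_mul, add_mul, mul_comm D M] at h3
  omega

/-- Incomparable discrete valuations give nontrivial, pairwise inequivalent real absolute values, so
the independence theorem for absolute values applies. -/
lemma exists_separating (h : IsProperPlaceFamily k v d) (s : Finset S) (x : S) (hx : x ∈ s) :
    ∃ f : K, 1 < v x f ∧ ∀ y ∈ s, y ≠ x → v y f < 1 := by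
  obtain ⟨f, hf, hf'⟩ := AbsoluteValue.exists_one_lt_lt_one_pi_of_not_isEquiv
    (v := fun y : s => intAbv (v y.1)) (fun y => by
      obtain ⟨π, hπ⟩ := h.uniformizer y.1
      refine ⟨π, ?_, ?_⟩
      · rintro rfl
        rw [map_zero] at hπ
        exact exp_ne_zero hπ.symm
      · refine ((intAbv_lt_one _ _).mpr ?_).ne
        rw [hπ, ← exp_zero, exp_lt_exp]
        norm_num)
    (fun a b hab heq => by
      obtain ⟨f, hf, hf'⟩ := h.incomparable a.1 b.1 (fun hc => hab (Subtype.ext hc))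
      rw [← one_lt_intAbv, ← heq.one_lt_iff, one_lt_intAbv] at hf'
      exact hf'.not_ge hf) ⟨x, hx⟩
  refine ⟨f, (one_lt_intAbv _ _).mp hf, fun y hy hyx => (intAbv_lt_one _ _).mp
    (hf' ⟨y, hy⟩ (fun hc => hyx (congr_arg Subtype.val hc)))⟩

/-- Approximate idempotents. -/
lemma exists_idempotent (h : IsProperPlaceFamily k v d)
    (s : Finset S) (x : S) (hx : x ∈ s) (n : ℕ) :
    ∃ e : K, v x (e - 1) ≤ exp (-(n : ℤ)) ∧ ∀ y ∈ s, y ≠ x → v y e ≤ exp (-(n : ℤ)) := by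
  obtain ⟨f, hf, hf'⟩ := h.exists_separating s x hx
  have key1 : ∀ y, v y f < 1 → v y (f ^ (n + 1)) < 1 := fun y hy => by
    rw [map_pow]
    exact pow_lt_one₀ zero_le hy (by simp)
  have hfx : 1 < v x (f ^ (n + 1)) := by
    rw [map_pow]
    exact one_lt_pow₀ hf (by simp)
  have hvx : v x (1 + f ^ (n + 1)) = v x (f ^ (n + 1)) := by
    refine Valuation.map_add_eq_of_lt_right (v x) ?_
    rw [map_one]
    exact hfx
  have hne : 1 + f ^ (n + 1) ≠ 0 := by
    intro h0
    rw [h0, map_zero] at hvx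
    rw [← hvx] at hfx
    exact not_lt_zero hfx
  -- With f large at x and small at the other places, this is close to 1 at x and close to 0
  -- elsewhere.
  refine ⟨f ^ (n + 1) / (1 + f ^ (n + 1)), ?_, fun y hy hyx => ?_⟩
  · have : f ^ (n + 1) / (1 + f ^ (n + 1)) - 1 = - (1 + f ^ (n + 1))⁻¹ := by
      field_simp
      ring
    rw [this, Valuation.map_neg, map_inv₀, hvx, map_pow, ← inv_pow]
    have hlt : (v x f)⁻¹ < 1 := inv_lt_one_of_one_lt₀ hf
    refine (pow_le_pow_right_of_le_one' hlt.le (Nat.le_succ n)).trans ?_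
    exact pow_le_exp_neg hlt n
  · have hvy : v y (1 + f ^ (n + 1)) = 1 := by
      rw [Valuation.map_add_eq_of_lt_left, map_one]
      rw [map_one]
      exact key1 y (hf' y hy hyx)
    rw [map_div₀, hvy, div_one, map_pow]
    refine (pow_le_pow_right_of_le_one' (hf' y hy hyx).le (Nat.le_succ n)).trans ?_
    exact pow_le_exp_neg (hf' y hy hyx) n

/-- Weak approximation. -/
lemma exists_approx (h : IsProperPlaceFamily k v d) (s : Finset S) (a : S → K) (n : ℕ) :
    ∃ b : K, ∀ x ∈ s, v x (b - a x) ≤ exp (-(n : ℤ)) := by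
  classical
  obtain ⟨l, hl⟩ : ∃ l : ℕ, ∀ x ∈ s, ∀ y ∈ s, v x (a y) ≤ exp (l : ℤ) := by
    refine ⟨∑ x ∈ s, ∑ y ∈ s, (log (v x (a y))).toNat, fun x hx y hy => ?_⟩
    by_cases h0 : a y = 0
    · simp [h0]
    rw [← log_le_iff_le_exp (by simpa using h0)]
    refine (Int.self_le_toNat _).trans ?_
    norm_cast
    exact (Finset.single_le_sum (f := fun z => (log (v x (a z))).toNat)
        (fun _ _ => Nat.zero_le _) hy).trans
      (Finset.single_le_sum (f := fun z => ∑ j ∈ s, (log (v z (a j))).toNat)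
        (fun _ _ => Nat.zero_le _) hx)
  -- The extra precision l absorbs the poles of the values `a y`.
  choose! e he he' using fun x (hx : x ∈ s) => h.exists_idempotent s x hx (n + l)
  have hexp : exp (-((n + l : ℕ) : ℤ)) * exp (l : ℤ) = exp (-(n : ℤ)) := by
    rw [← exp_add]
    congr 1
    push_cast
    ring
  refine ⟨∑ y ∈ s, e y * a y, fun x hx => ?_⟩
  rw [← Finset.add_sum_erase _ _ hx, add_sub_right_comm]
  refine (v x).map_add_le ?_ ((v x).map_sum_le fun y hy => ?_)
  · rw [show e x * a x - a x = (e x - 1) * a x by ring, map_mul, ← hexp]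
    exact mul_le_mul' (he x hx) (hl x hx x hx)
  · rw [map_mul, ← hexp]
    have hy' := Finset.mem_erase.mp hy
    exact mul_le_mul' (he' y hy'.2 x hx (Ne.symm hy'.1)) (hl x hx y hy'.2)

/-- There are as many elements of `K` linearly independent over `k(g)` as the degree of the divisor
of zeros of `g`. -/
lemma exists_independent (h : IsProperPlaceFamily k v d)
    (g : K) (hg : g ≠ 0) (s : Finset S) (hs : ∀ x ∈ s, v x g ≤ 1) :
    ∃ b : Fin (∑ x ∈ s, (log (v x g⁻¹)).toNat * d x) → K,
      ∀ P : Fin _ → k[X], ∑ i, aeval g (P i) * b i = 0 → P = 0 := by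
  classical
  set n : S → ℕ := fun x => (log (v x g⁻¹)).toNat with hn
  have hvn : ∀ x ∈ s, v x g = exp (-(n x : ℤ)) := by
    intro x hx
    have h0 : v x g ≠ 0 := by simpa using hg
    have : log (v x g) ≤ 0 := by
      rw [log_le_iff_le_exp h0]
      simpa using hs x hx
    change v x g = exp (-((log (v x g⁻¹)).toNat : ℤ))
    rw [map_inv₀, log_inv, Int.toNat_of_nonneg (by omega), neg_neg, exp_log h0]
  -- `Q x` is the local ring at x modulo g. A k-basis of the product of these over the zeros of g,
  -- lifted to K by weak approximation, is the required family.
  let Q : S → Type _ := fun x =>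
    relQuot (valFilt (v x) (h.const x) (-(n x : ℤ))) (valFilt (v x) (h.const x) 0)
  let (x : S) : AddCommGroup (Q x) := inferInstanceAs (AddCommGroup (relQuot _ _))
  let (x : S) : Module k (Q x) := inferInstanceAs (Module k (relQuot _ _))
  have hQ : ∀ x, Module.length k (Q x) = (n x * d x : ℕ) := by
    intro x
    have := h.length_filt x (-(n x : ℤ)) (n x)
    rw [neg_add_cancel] at this
    exact this
  have hT : Module.length k (Π x : s, Q x) = (∑ x ∈ s, n x * d x : ℕ) := by
    rw [Module.length_pi_of_fintype, ← Finset.sum_coe_sort s (fun x => n x * d x), Nat.cast_sum]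
    exact Finset.sum_congr rfl fun x _ => hQ x
  have hfin : IsFiniteLength k (Π x : s, Q x) := by
    rw [← Module.length_ne_top_iff, hT]
    exact ENat.natCast_ne_top _
  have := (isFiniteLength_iff_isNoetherian_isArtinian.mp hfin).1
  have hrank : Module.finrank k (Π x : s, Q x) = ∑ x ∈ s, n x * d x := by
    rw [Module.length_of_free, ← Module.finrank_eq_rank, Cardinal.toENat_nat, Module.length_eq_one,
      mul_one] at hT
    exact_mod_cast hT
  let β := Module.finBasisOfFinrankEq k (Π x : s, Q x) hrank
  have hlift : ∀ i, ∃ b : K, ∀ x : s, ∃ hb : b ∈ valFilt (v x) (h.const x) 0,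
      relQuot.mk (valFilt (v x) (h.const x) (-(n x : ℤ))) _ ⟨b, hb⟩ = β i x := by
    intro i
    choose a ha using fun x : s => relQuot.mk_surjective _ _ (β i x)
    have hle : ∀ x ∈ s, n x ≤ ∑ y ∈ s, n y := fun x hx =>
      Finset.single_le_sum (f := n) (fun _ _ => Nat.zero_le _) hx
    obtain ⟨b, hb⟩ := h.exists_approx s (fun x => if hx : x ∈ s then (a ⟨x, hx⟩ : K) else 0) (∑ y ∈ s, n y)
    refine ⟨b, fun x => ?_⟩
    have hbx : v x (b - a x) ≤ exp (-(n x : ℤ)) := by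
      have := hb x x.2
      simp only [x.2, dite_true] at this
      refine this.trans ?_
      rw [exp_le_exp]
      have := hle x x.2
      omega
    have hmem : b ∈ valFilt (v x) (h.const x) 0 := by
      have h1 : b - a x ∈ valFilt (v x) (h.const x) 0 :=
        valFilt_mono _ _ (by simp) (mem_valFilt.mpr hbx)
      simpa using Submodule.add_mem _ h1 (a x).2
    refine ⟨hmem, ?_⟩
    rw [← ha x, ← sub_eq_zero, ← map_sub, relQuot.mk_eq_zero]
    exact hbx
  choose b hb hbβ using hlift
  have step : ∀ P : Fin (∑ x ∈ s, n x * d x) → k[X], ∑ i, aeval g (P i) * b i = 0 →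
      ∀ i, (P i).coeff 0 = 0 := by
    intro P hP
    -- Modulo g a relation retains only its constant terms, so it becomes a k-linear relation
    -- between basis vectors.
    have h1 : ∑ i, (P i).coeff 0 • b i = - (g * ∑ i, aeval g (divX (P i)) * b i) := by
      rw [eq_neg_iff_add_eq_zero, ← hP, Finset.mul_sum, ← Finset.sum_add_distrib]
      refine Finset.sum_congr rfl fun i _ => ?_
      conv_rhs => rw [← X_mul_divX_add (P i)]
      rw [map_add, map_mul, aeval_X, aeval_C, Algebra.smul_def]
      ring
    have h2 : ∑ i, (P i).coeff 0 • β i = 0 := by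
      ext x
      have hmem : ∑ i, (P i).coeff 0 • b i ∈ valFilt (v x) (h.const x) (-(n x : ℤ)) := by
        rw [h1, mem_valFilt, Valuation.map_neg, map_mul, hvn x x.2]
        refine mul_le_of_le_one_right' ?_
        refine (v x).map_sum_le fun i _ => ?_
        rw [map_mul]
        refine mul_le_one' ?_ (by simpa using mem_valFilt.mp (hb i x))
        rw [aeval_eq_sum_range]
        refine (v x).map_sum_le fun j _ => ?_
        rw [Algebra.smul_def, map_mul, map_pow]
        exact mul_le_one' (h.const _ _) (pow_le_one' (hs x x.2) _)
      have h3 : (∑ i, (P i).coeff 0 • β i) x =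
          relQuot.mk (valFilt (v x) (h.const x) (-(n x : ℤ))) (valFilt (v x) (h.const x) 0)
            (∑ i, (P i).coeff 0 • ⟨b i, hb i x⟩) := by
        rw [Finset.sum_apply, map_sum]
        refine Finset.sum_congr rfl fun i _ => ?_
        rw [map_smul, hbβ, Pi.smul_apply]
      rw [h3, Pi.zero_apply]
      refine relQuot.mk_eq_zero.mpr ?_
      simpa using hmem
    exact Fintype.linearIndependent_iff.mp β.linearIndependent _ h2
  -- Once the constant terms vanish, the relation can be divided by g, which shifts all coefficients
  -- down by one.
  have all : ∀ m : ℕ, ∀ P : Fin (∑ x ∈ s, n x * d x) → k[X], ∑ i, aeval g (P i) * b i = 0 →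
      ∀ i, (P i).coeff m = 0 := by
    intro m
    induction m with
    | zero => exact step
    | succ m ih =>
      intro P hP i
      have h0 := step P hP
      have h1 : g * ∑ i, aeval g (divX (P i)) * b i = 0 := by
        rw [← hP, Finset.mul_sum]
        refine Finset.sum_congr rfl fun i _ => ?_
        conv_rhs => rw [← X_mul_divX_add (P i), h0 i]
        rw [map_add, map_mul, aeval_X, aeval_C, map_zero]
        ring
      have h2 := ih (fun i => divX (P i)) ((mul_eq_zero.mp h1).resolve_left hg) i
      rwa [coeff_divX] at h2
  refine ⟨b, fun P hP => ?_⟩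
  ext i m
  simpa using all m P hP i

/-- Both sides are compared with the size of a family independent over k[g]. Places where g has a
pole contribute 0 on the left, by truncation. -/
lemma degree_zeros_le (h : IsProperPlaceFamily k v d)
    (g : K) (hg : g ≠ 0) (s : Finset S) (hs : ∀ x ∉ s, v x g = 1) :
    ∑ x ∈ s, (log (v x g⁻¹)).toNat * d x ≤ ∑ x ∈ s, (log (v x g)).toNat * d x := by
  classical
  obtain ⟨b, hb⟩ := h.exists_independent g hg (s.filter fun x => v x g ≤ 1)
    (fun x hx => (Finset.mem_filter.mp hx).2)
  have h1 := h.card_le_degree_poles g s (fun x hx => (hs x hx).le) b hb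
  refine le_trans (le_of_eq ?_) h1
  rw [Finset.sum_filter]
  refine Finset.sum_congr rfl fun x _ => ?_
  split_ifs with hx
  · rfl
  · have h0 : v x g ≠ 0 := by simpa using hg
    have : 0 ≤ log (v x g) := by
      rw [not_le, ← exp_zero, ← log_exp (0 : ℤ), ← log_lt_log (by simp) h0] at hx
      simpa using hx.le
    rw [map_inv₀, log_inv, Int.toNat_eq_zero.mpr (by omega), zero_mul]

/-- The product formula: the degree of a principal divisor is zero. -/
theorem finsum_log_mul_eq_zero (h : IsProperPlaceFamily k v d)
    (g : K) (hg : g ≠ 0) : ∑ᶠ x, log (v x g) * (d x : ℤ) = 0 := by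
  classical
  set s := (h.finite g hg).toFinset with hsdef
  have hs : ∀ x ∉ s, v x g = 1 := fun x hx => by
    by_contra hc
    exact hx ((h.finite g hg).mem_toFinset.mpr hc)
  rw [finsum_eq_sum_of_support_subset (s := s)]
  · have h1 := h.degree_zeros_le g hg s hs
    have h2 := h.degree_zeros_le g⁻¹ (inv_ne_zero hg) s (fun x hx => by rw [map_inv₀, hs x hx, inv_one])
    rw [inv_inv] at h2
    have h3 : ∀ x ∈ s, log (v x g) * (d x : ℤ) =
        (((log (v x g)).toNat * d x : ℕ) : ℤ) - (((log (v x g⁻¹)).toNat * d x : ℕ) : ℤ) := by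
      intro x _
      rw [map_inv₀, log_inv]
      push_cast
      rw [← sub_mul, Int.toNat_sub_toNat_neg]
    rw [Finset.sum_congr rfl h3, Finset.sum_sub_distrib, ← Nat.cast_sum, ← Nat.cast_sum]
    omega
  · intro x hx
    by_contra hc
    apply hx
    simp only [hs x hc, log_one, zero_mul]

end IsProperPlaceFamily

end ProductFormula

/-! ### Local rings and closed points of a smooth curve. -/

section LocalRing

open IsLocalRing

/-- An étale map is unramified, so the maximal ideal of T is generated by the image of that of the
local ring below it on the affine line; the latter is principal because polynomials in one variable
over a field form a principal ideal domain. -/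
lemma isPrincipal_maximalIdeal_of_etale {R B T : Type u} [CommRing R] [CommRing B] [CommRing T]
    (hR : IsField R) (g : MvPolynomial (Fin 1) R →+* B) (hg : g.Etale) [Algebra B T]
    (q : Ideal B) [q.IsPrime] [IsLocalization.AtPrime T q] [IsLocalRing T] :
    (maximalIdeal T).IsPrincipal := by
  let := hR.toField
  algebraize [g, (algebraMap B T).comp g]
  have hunr : Algebra.FormallyUnramified (MvPolynomial (Fin 1) R) B := inferInstance
  have hPID : IsPrincipalIdealRing (MvPolynomial (Fin 1) R) :=
    IsPrincipalIdealRing.of_surjective (MvPolynomial.uniqueAlgEquiv R (Fin 1)).symm.toRingHom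
      (MvPolynomial.uniqueAlgEquiv R (Fin 1)).symm.surjective
  let A := MvPolynomial (Fin 1) R
  let p : Ideal A := q.comap g
  let Ap := Localization.AtPrime p
  let φ : Ap →+* T := IsLocalization.lift (M := p.primeCompl) (g := algebraMap A T) (by
    intro y
    have : g y ∈ q.primeCompl := y.2
    exact IsLocalization.map_units T ⟨g y, this⟩)
  let : Algebra Ap T := φ.toAlgebra
  have : IsScalarTower A Ap T := IsScalarTower.of_algebraMap_eq' (IsLocalization.lift_comp _).symm
  have hunr2 : Algebra.FormallyUnramified B T := .of_isLocalization q.primeCompl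
  have : Algebra.FormallyUnramified A T := .comp A B T
  have : Algebra.FormallyUnramified Ap T := .of_restrictScalars A Ap T
  have : Algebra.EssFiniteType B T := .of_isLocalization T q.primeCompl
  have : Algebra.EssFiniteType A T := .comp A B T
  have : Algebra.EssFiniteType Ap T := .of_comp A Ap T
  have : IsLocalHom (algebraMap Ap T) := by
    refine ⟨fun a ha => ?_⟩
    obtain ⟨a, s, rfl⟩ := IsLocalization.exists_mk'_eq p.primeCompl a
    have h1 : IsUnit (algebraMap A T a) := by
      have : algebraMap A T a = algebraMap Ap T (IsLocalization.mk' Ap a s) *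
          algebraMap A T s := by
        rw [IsScalarTower.algebraMap_apply A Ap T, IsScalarTower.algebraMap_apply A Ap T s, ← map_mul,
          IsLocalization.mk'_spec]
      rw [this]
      exact ha.mul (IsLocalization.map_units T (⟨g s, s.2⟩ : q.primeCompl))
    have h2 : a ∈ p.primeCompl := by
      intro hap
      have : algebraMap B T (g a) ∈ maximalIdeal T :=
        (IsLocalization.AtPrime.to_map_mem_maximal_iff T q (g a)).mpr hap
      exact this h1
    exact (IsLocalization.AtPrime.isUnit_mk'_iff Ap p a s).mpr h2
  rw [← Algebra.FormallyUnramified.map_maximalIdeal (R := Ap) (S := T)]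
  rw [← Localization.AtPrime.map_eq_maximalIdeal, Ideal.map_map]
  obtain ⟨a, ha⟩ := (inferInstance : p.IsPrincipal)
  have hmap : ∀ ψ : A →+* T, p.map ψ = Ideal.span {ψ a} := fun ψ => by
    rw [ha, ← Ideal.span, Ideal.map_span, Set.image_singleton]
  rw [hmap]
  exact ⟨⟨_, rfl⟩⟩

end LocalRing

namespace SmoothProjectiveCurve

variable {k : Type u} [Field k] (C : SmoothProjectiveCurve k)

lemma isPrincipal_maximalIdeal_stalk (x : C.X) :
    (IsLocalRing.maximalIdeal (C.X.presheaf.stalk x)).IsPrincipal := by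
  obtain ⟨U, hU, V, hV, hxV, e, hf⟩ :=
    SmoothOfRelativeDimension.exists_isStandardSmoothOfRelativeDimension (n := 1) (f := C.hom) x
  -- The spectrum of a field is one point.
  have hUtop : U = ⊤ := by
    ext y
    have : y = C.hom x := Subsingleton.elim (α := PrimeSpectrum k) _ _
    simpa [this] using e hxV
  subst hUtop
  obtain ⟨g, -, hg⟩ := hf.exists_etale_mvPolynomial
  have hR : IsField Γ(Spec (.of k), ⊤) :=
    (Scheme.ΓSpecIso (.of k)).commRingCatIsoToRingEquiv.toMulEquiv.isField (Field.toIsField k)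
  let : Algebra Γ(C.X, V) (C.X.presheaf.stalk x) := (C.X.presheaf.germ V x hxV).hom.toAlgebra
  have := hV.isLocalization_stalk ⟨x, hxV⟩
  exact isPrincipal_maximalIdeal_of_etale hR g hg (hV.primeIdealOf ⟨x, hxV⟩).asIdeal

lemma le_genericPoint (x : C.X) : x ≤ genericPoint C.X :=
  genericPoint_specializes x

lemma le_antisymm {x y : C.X} (hxy : x ≤ y) (hyx : y ≤ x) : x = y :=
  (Specializes.antisymm (show x ⤳ y from hyx) (show y ⤳ x from hxy)).eq

/-- The Krull dimension of the stalk is the coheight of x in the specialization order, whose top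
element is the generic point. -/
lemma not_isField_stalk {x : C.X} (hx : x ≠ genericPoint C.X) :
    ¬ IsField (C.X.presheaf.stalk x) := by
  intro hF
  have h0 := ringKrullDim_eq_zero_of_isField hF
  rw [ringKrullDim_stalk_eq_coheight] at h0
  have h1 : Order.coheight x = 0 := by exact_mod_cast h0
  rw [Order.coheight_eq_zero] at h1
  exact hx (C.le_antisymm (C.le_genericPoint x) (h1 (C.le_genericPoint x)))

lemma isDiscreteValuationRing_stalk {x : C.X} (hx : x ≠ genericPoint C.X) :
    IsDiscreteValuationRing (C.X.presheaf.stalk x) :=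
  ((IsDiscreteValuationRing.TFAE _ (C.not_isField_stalk hx)).out 0 4).mpr
    (C.isPrincipal_maximalIdeal_stalk x)

lemma isPrincipalIdealRing_stalk (x : C.X) : IsPrincipalIdealRing (C.X.presheaf.stalk x) := by
  by_cases hx : x = genericPoint C.X
  · subst hx
    exact inferInstanceAs (IsPrincipalIdealRing C.X.functionField)
  · have := C.isDiscreteValuationRing_stalk hx
    infer_instance

lemma coheight_eq_one {x : C.X} (hx : x ≠ genericPoint C.X) : Order.coheight x = 1 := by
  have := C.isDiscreteValuationRing_stalk hx
  have h1 := IsDiscreteValuationRing.ringKrullDim_eq_one (C.X.presheaf.stalk x)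
  rw [ringKrullDim_stalk_eq_coheight] at h1
  exact_mod_cast h1

lemma coheight_genericPoint : Order.coheight (genericPoint C.X) = 0 := by
  rw [Order.coheight_eq_zero]
  exact fun y _ => C.le_genericPoint y

/-- A proper specialization would raise the coheight, but every nongeneric point has coheight 1. -/
lemma eq_of_specializes {x y : C.X} (hx : x ≠ genericPoint C.X) (h : x ⤳ y) : y = x := by
  by_contra hne
  have hyx : y < x := lt_of_le_not_ge h fun hc => hne (C.le_antisymm h hc)
  have h1 := Order.coheight_add_one_le hyx
  have hy : y ≠ genericPoint C.X := fun hc => hne (C.le_antisymm h (hc ▸ C.le_genericPoint x))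
  rw [C.coheight_eq_one hx, C.coheight_eq_one hy] at h1
  norm_num at h1

lemma isClosed_singleton {x : C.X} (hx : x ≠ genericPoint C.X) : IsClosed {x} := by
  have : closure {x} = {x} := by
    refine Set.Subset.antisymm (fun y hy => ?_) subset_closure
    exact C.eq_of_specializes hx (specializes_iff_mem_closure.mpr hy)
  rw [← this]
  exact isClosed_closure

instance : CompactSpace C.X := (quasiCompact_iff_compactSpace C.hom).mp inferInstance

instance : IsNoetherian C.X where

/-- A nonempty open subset of a curve omits only finitely many points. -/
lemma finite_compl (U : C.X.Opens) (hU : genericPoint C.X ∈ U) : ((U : Set C.X)ᶜ).Finite := by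
  -- The complement is a finite union of irreducible closed sets; each has a nongeneric generic
  -- point and is therefore a single point.
  obtain ⟨S, hSfin, hS, heq⟩ :=
    TopologicalSpace.NoetherianSpace.exists_finite_set_isClosed_irreducible U.isOpen.isClosed_compl
  rw [heq.2]
  refine Set.Finite.sUnion hSfin fun Z hZ => ?_
  have hirr := heq.1 Z hZ
  have hgen := hirr.isGenericPoint_genericPoint (hS Z hZ)
  have hne : hirr.genericPoint ≠ genericPoint C.X := by
    intro hc
    have hmem : hirr.genericPoint ∈ Z := hgen.mem
    have : hirr.genericPoint ∈ ((U : Set C.X)ᶜ) := heq.2 ▸ Set.mem_sUnion.mpr ⟨Z, hZ, hmem⟩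
    rw [hc] at this
    exact this hU
  refine (Set.finite_singleton hirr.genericPoint).subset fun y hy => ?_
  exact C.eq_of_specializes hne (hgen.specializes hy)

end SmoothProjectiveCurve

/-! ### The closed points of a curve as a proper family of places. -/

namespace SmoothProjectiveCurve

open WithZero IsLocalRing

variable {k : Type u} [Field k] (C : SmoothProjectiveCurve k)

/-- The inclusion of the constants into the local ring at a point. -/
noncomputable def toStalk (x : C.X) : k →+* C.X.presheaf.stalk x :=
  ((Scheme.ΓSpecIso (.of k)).inv ≫ C.hom.appTop ≫ C.X.presheaf.germ ⊤ x trivial).hom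

noncomputable instance algebraFunctionField : Algebra k C.X.functionField :=
  (C.toStalk (genericPoint C.X)).toAlgebra

lemma algebraMap_toStalk (x : C.X) (c : k) :
    algebraMap (C.X.presheaf.stalk x) C.X.functionField (C.toStalk x c) =
      algebraMap k C.X.functionField c := by
  have : Nonempty (⊤ : C.X.Opens) := ⟨⟨x, trivial⟩⟩
  exact Scheme.algebraMap_germ_eq_germToFunctionField C.X (U := ⊤) (x := x) trivial _

/-- The closed points. -/
abbrev ClosedPoint := {x : C.X // x ≠ genericPoint C.X}

noncomputable instance (x : C.ClosedPoint) : IsDiscreteValuationRing (C.X.presheaf.stalk x.1) :=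
  C.isDiscreteValuationRing_stalk x.2

/-- The valuation of the function field given by a closed point. -/
noncomputable def val (x : C.ClosedPoint) : Valuation C.X.functionField ℤᵐ⁰ :=
  (IsDiscreteValuationRing.maximalIdeal (C.X.presheaf.stalk x.1)).valuation C.X.functionField

lemma val_algebraMap_le_one (x : C.ClosedPoint) (a : C.X.presheaf.stalk x.1) :
    C.val x (algebraMap _ _ a) ≤ 1 :=
  IsDedekindDomain.HeightOneSpectrum.valuation_le_one _ _

lemma exists_of_val_le_one {x : C.ClosedPoint} {f : C.X.functionField} (hf : C.val x f ≤ 1) :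
    ∃ a : C.X.presheaf.stalk x.1, algebraMap _ _ a = f :=
  IsDiscreteValuationRing.exists_lift_of_le_one hf

lemma val_algebraMap_lt_one_iff (x : C.ClosedPoint) (a : C.X.presheaf.stalk x.1) :
    C.val x (algebraMap _ _ a) < 1 ↔ a ∈ maximalIdeal (C.X.presheaf.stalk x.1) :=
  IsDedekindDomain.HeightOneSpectrum.valuation_lt_one_iff_mem _ _

lemma val_const_le_one (x : C.ClosedPoint) (c : k) : C.val x (algebraMap k _ c) ≤ 1 := by
  rw [← C.algebraMap_toStalk x.1]
  exact C.val_algebraMap_le_one x _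

lemma ord_eq_neg_log_val (x : C.ClosedPoint) (f : C.X.functionField) :
    C.X.ord f x.1 = - log (C.val x f) := by
  have hx := C.coheight_eq_one x.2
  rw [Scheme.ord_eq_ordHom_of_coheight_eq_one hx]
  have h1 : C.X.ordHom x.1 hx f = (C.val x f)⁻¹ := Ring.ordFrac_eq_valuation_inv f
  rw [h1, ← log_inv]
  generalize (C.val x f)⁻¹ = a
  cases a <;> rfl

lemma ord_genericPoint (f : C.X.functionField) : C.X.ord f (genericPoint C.X) = 0 := by
  refine Scheme.ord_eq_zero_of_coheight_neq_one ?_ f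
  rw [C.coheight_genericPoint]
  exact zero_ne_one

/-- The Nullstellensatz: the spectrum of the residue field is a closed subscheme, hence locally of
finite type over k, and a one-point scheme of this kind is finite. -/
lemma finite_residueField (x : C.ClosedPoint) : (C.toResidueField x.1).Finite := by
  have := isClosed_singleton_iff_isClosedImmersion.mp (C.isClosed_singleton x.2)
  have hfin : IsFinite (C.X.fromSpecResidueField x.1 ≫ C.hom) :=
    (isFinite_iff_locallyOfFiniteType_of_jacobsonSpace
      (f := C.X.fromSpecResidueField x.1 ≫ C.hom)).mpr inferInstance
  have heq : C.X.fromSpecResidueField x.1 ≫ C.hom =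
      Spec.map (CommRingCat.ofHom (C.toResidueField x.1)) := by
    have hhom : C.hom = C.X.toSpecΓ ≫ Spec.map ((Scheme.ΓSpecIso (.of k)).inv ≫ C.hom.appTop) := by
      rw [Spec.map_comp, ← Scheme.toSpecΓ_naturality_assoc, toSpecΓ_SpecMap_ΓSpecIso_inv,
        Category.comp_id]
    conv_lhs => rw [hhom]
    rw [Scheme.fromSpecResidueField, Category.assoc, Scheme.fromSpecStalk_toSpecΓ_assoc,
      ← Spec.map_comp, ← Spec.map_comp]
    rfl
  rw [heq, IsFinite.SpecMap_iff] at hfin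
  exact hfin

/-- The stalk maps k-linearly onto both the valuation-theoretic residue quotient and the residue
field of the scheme, with the same kernel. -/
lemma length_residue (x : C.ClosedPoint) :
    Module.length k (relQuot (valFilt (C.val x) (C.val_const_le_one x) (-1))
      (valFilt (C.val x) (C.val_const_le_one x) 0)) = C.pointDegree x.1 := by
  let : Algebra k (C.X.presheaf.stalk x.1) := (C.toStalk x.1).toAlgebra
  let : Algebra k (C.X.residueField x.1) := (C.toResidueField x.1).toAlgebra
  have hfin : Module.Finite k (C.X.residueField x.1) := C.finite_residueField x
  have hsmul : ∀ (c : k) (a : C.X.presheaf.stalk x.1),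
      algebraMap (C.X.presheaf.stalk x.1) C.X.functionField (c • a) = c • algebraMap _ _ a := by
    intro c a
    rw [Algebra.smul_def, map_mul, Algebra.smul_def, ← C.algebraMap_toStalk x.1]
    rfl
  let ι : C.X.presheaf.stalk x.1 →ₗ[k] valFilt (C.val x) (C.val_const_le_one x) 0 :=
    { toFun := fun a => ⟨algebraMap _ _ a, by
        simpa [mem_valFilt] using C.val_algebraMap_le_one x a⟩
      map_add' := fun a b => Subtype.ext (map_add _ a b)
      map_smul' := fun c a => Subtype.ext (hsmul c a) }
  let φ := relQuot.mk (valFilt (C.val x) (C.val_const_le_one x) (-1)) _ ∘ₗ ι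
  have hφ : Function.Surjective φ := by
    intro q
    obtain ⟨f, rfl⟩ := relQuot.mk_surjective _ _ q
    obtain ⟨a, ha⟩ := C.exists_of_val_le_one (x := x) (f := f.1) f.2
    exact ⟨a, congr_arg _ (Subtype.ext ha)⟩
  let ψ : C.X.presheaf.stalk x.1 →ₗ[k] C.X.residueField x.1 :=
    { toFun := fun a => (C.X.residue x.1).hom a
      map_add' := fun a b => map_add _ a b
      map_smul' := fun c a => by
        rw [Algebra.smul_def, map_mul, RingHom.id_apply, Algebra.smul_def]
        rfl }
  have hψ : Function.Surjective ψ := IsLocalRing.residue_surjective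
  have hker : LinearMap.ker φ = LinearMap.ker ψ := by
    ext a
    rw [LinearMap.mem_ker, LinearMap.mem_ker]
    change relQuot.mk _ _ (ι a) = 0 ↔ IsLocalRing.residue _ a = 0
    rw [relQuot.mk_eq_zero, IsLocalRing.residue_eq_zero_iff, ← C.val_algebraMap_lt_one_iff,
      mem_valFilt]
    change C.val x (algebraMap _ _ a) ≤ exp (-1) ↔ _
    rcases eq_or_ne (C.val x (algebraMap _ _ a)) 0 with h0 | h0
    · simp [h0]
    rw [← log_le_iff_le_exp h0, ← exp_zero, ← log_lt_iff_lt_exp h0]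
    omega
  let e := (φ.quotKerEquivOfSurjective hφ).symm ≪≫ₗ Submodule.quotEquivOfEq _ _ hker ≪≫ₗ
    ψ.quotKerEquivOfSurjective hψ
  rw [e.length_eq, Module.length_of_free, ← Module.finrank_eq_rank, Cardinal.toENat_nat,
    Module.length_eq_one, mul_one]
  rfl

lemma finite_val_ne_one (f : C.X.functionField) (hf : f ≠ 0) : {x | C.val x f ≠ 1}.Finite := by
  obtain ⟨U, -, f', hU, rfl, hf'⟩ := exists_isUnit_germ_eq C.X f hf
  have hη : genericPoint C.X ∈ U :=
    ((genericPoint_spec C.X).mem_open_set_iff U.isOpen).mpr (by simpa using hU)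
  refine Set.Finite.of_finite_image (f := Subtype.val) ?_ Subtype.val_injective.injOn
  refine (C.finite_compl U hη).subset ?_
  rintro _ ⟨x, hx, rfl⟩ hxU
  have h1 := Scheme.ord_of_isUnit hf' (x := x.1) hxU
  rw [C.ord_eq_neg_log_val, neg_eq_zero] at h1
  have h0 : C.val x (C.X.germToFunctionField U f') ≠ 0 := by simpa using hf
  apply hx
  rw [← exp_log h0, h1, exp_zero]

instance : C.X.IsSeparated := by
  have : IsSeparated (C.hom ≫ Limits.terminal.from _) := inferInstance
  rw [Limits.terminal.comp_from] at this
  exact ⟨this⟩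

/-- The valuative argument for separatedness: an inclusion of the valuation ring of x in that of y
would make the second dominate the first, and then the two points would coincide. -/
lemma incomparable (x y : C.ClosedPoint) (hxy : x ≠ y) :
    ∃ f : C.X.functionField, C.val x f ≤ 1 ∧ 1 < C.val y f := by
  by_contra! hcon
  have hlt : ∀ f, C.val x f < 1 → C.val y f < 1 := by
    intro f hf
    refine lt_of_le_of_ne (hcon f hf.le) fun h1 => ?_
    obtain ⟨π, hπ⟩ : ∃ π, C.val y π = exp (-1) :=
      IsDedekindDomain.HeightOneSpectrum.valuation_exists_uniformizer _ _
    set n := (log (C.val x π⁻¹)).toNat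
    -- If f vanished at x but were a unit at y, this function would be regular at x and have a pole
    -- at y.
    have h2 : C.val x (π⁻¹ * f ^ n) ≤ 1 := by
      by_cases h0 : π = 0
      · simp [h0]
      rw [map_mul, map_pow]
      have h3 : C.val x π⁻¹ ≤ exp (n : ℤ) := by
        rw [← log_le_iff_le_exp (by simpa using h0)]
        exact Int.self_le_toNat _
      refine (mul_le_mul' h3 (WithZero.pow_le_exp_neg hf n)).trans ?_
      rw [← exp_add]
      simp
    have h4 := hcon _ h2
    rw [map_mul, map_pow, h1, one_pow, mul_one, map_inv₀, hπ, ← exp_neg, ← exp_zero, exp_le_exp] at h4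
    norm_num at h4
  choose ψ hψ using fun a : C.X.presheaf.stalk x.1 =>
    C.exists_of_val_le_one (hcon _ (C.val_algebraMap_le_one x a))
  have hinj := IsFractionRing.injective (C.X.presheaf.stalk y.1) C.X.functionField
  let Ψ : C.X.presheaf.stalk x.1 →+* C.X.presheaf.stalk y.1 :=
    { toFun := ψ
      map_one' := hinj (by rw [hψ, map_one, map_one])
      map_zero' := hinj (by rw [hψ, map_zero, map_zero])
      map_add' := fun a b => hinj (by rw [hψ, map_add, map_add, hψ, hψ])
      map_mul' := fun a b => hinj (by rw [hψ, map_mul, map_mul, hψ, hψ]) }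
  have hloc : IsLocalHom Ψ := by
    refine ((local_hom_TFAE Ψ).out 0 4).mpr ?_
    refine (((maximalIdeal.isMaximal _).eq_of_le (Ideal.IsPrime.ne_top inferInstance)
      fun a ha => ?_)).symm
    rw [Ideal.mem_comap, ← C.val_algebraMap_lt_one_iff]
    change C.val y (algebraMap _ _ (ψ a)) < 1
    rw [hψ]
    exact hlt _ ((C.val_algebraMap_lt_one_iff x a).mpr ha)
  let spx := C.X.presheaf.stalkSpecializes (genericPoint_specializes x.1)
  let spy := C.X.presheaf.stalkSpecializes (genericPoint_specializes y.1)
  have hcomp : CommRingCat.ofHom Ψ ≫ spy = spx := by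
    ext a
    exact hψ a
  have hdom : IsDominant (Spec.map spy) := by
    refine ⟨(PrimeSpectrum.denseRange_comap_iff_ker_le_nilRadical spy.hom).mpr ?_⟩
    rw [(RingHom.injective_iff_ker_eq_bot spy.hom).mp hinj]
    exact bot_le
  -- Both maps from the spectrum of the stalk at y agree on the dense generic point, and the curve
  -- is separated. Closed points are then compared, `Ψ` being local.
  have heq : Spec.map (CommRingCat.ofHom Ψ) ≫ C.X.fromSpecStalk x.1 = C.X.fromSpecStalk y.1 := by
    refine ext_of_isDominant (Spec.map spy) ?_
    rw [← Spec.map_comp_assoc, hcomp, Scheme.SpecMap_stalkSpecializes_fromSpecStalk,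
      Scheme.SpecMap_stalkSpecializes_fromSpecStalk]
  have h2 : Spec.map (CommRingCat.ofHom Ψ) (closedPoint (C.X.presheaf.stalk y.1)) =
      closedPoint (C.X.presheaf.stalk x.1) := IsLocalRing.comap_closedPoint Ψ
  refine hxy (Subtype.ext ?_)
  calc x.1 = C.X.fromSpecStalk x.1 (closedPoint (C.X.presheaf.stalk x.1)) :=
        Scheme.fromSpecStalk_closedPoint.symm
    _ = C.X.fromSpecStalk x.1 (Spec.map (CommRingCat.ofHom Ψ)
          (closedPoint (C.X.presheaf.stalk y.1))) := congr_arg (C.X.fromSpecStalk x.1) h2.symm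
    _ = C.X.fromSpecStalk y.1 (closedPoint (C.X.presheaf.stalk y.1)) := by
        rw [← heq]
        rfl
    _ = y.1 := Scheme.fromSpecStalk_closedPoint

/-- Local lifts of f all have generic germ f, and on an integral scheme the generic germ determines
a section, so they glue. -/
lemma exists_section_of_regular (f : C.X.functionField) (hf : ∀ x, C.val x f ≤ 1) :
    ∃ s : Γ(C.X, ⊤), C.X.presheaf.germ ⊤ (genericPoint C.X) trivial s = f := by
  have hloc : ∀ x : C.X, ∃ a : C.X.presheaf.stalk x, algebraMap _ C.X.functionField a = f := by
    intro x
    by_cases hx : x = genericPoint C.X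
    · subst hx
      refine ⟨f, ?_⟩
      change (C.X.presheaf.stalkSpecializes (specializes_refl _)).hom f = f
      rw [TopCat.Presheaf.stalkSpecializes_refl]
      rfl
    · exact C.exists_of_val_le_one (hf ⟨x, hx⟩)
  choose a ha using hloc
  choose U hxU s hs using fun x => C.X.presheaf.exists_germ_eq (a x)
  have hη : ∀ x, genericPoint C.X ∈ U x := fun x =>
    ((genericPoint_spec C.X).mem_open_set_iff (U x).isOpen).mpr ⟨x, trivial, hxU x⟩
  have hsf : ∀ x, C.X.presheaf.germ (U x) (genericPoint C.X) (hη x) (s x) = f := by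
    intro x
    have : Nonempty (U x) := ⟨⟨x, hxU x⟩⟩
    rw [← ha x, ← hs x]
    exact (Scheme.algebraMap_germ_eq_germToFunctionField C.X (hxU x) (s x)).symm
  obtain ⟨t, ht, -⟩ := C.X.sheaf.existsUnique_gluing' U ⊤ (fun x => homOfLE le_top)
    (fun x _ => TopologicalSpace.Opens.mem_iSup.mpr ⟨x, hxU x⟩) s (by
      intro x y
      apply germ_injective_of_isIntegral C.X (U := U x ⊓ U y) (genericPoint C.X) ⟨hη x, hη y⟩
      refine (TopCat.Presheaf.germ_res_apply _ _ _ _ _).trans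
        (Eq.trans ?_ (TopCat.Presheaf.germ_res_apply _ _ _ _ _).symm)
      exact (hsf x).trans (hsf y).symm)
  refine ⟨t, ?_⟩
  rw [← hsf (genericPoint C.X), ← ht (genericPoint C.X)]
  exact (TopCat.Presheaf.germ_res_apply _ _ _ _ _).symm

/-- Regular rational functions are global sections, and these are finite-dimensional by properness.
-/
lemma length_global : Module.length k
    (⨅ x, valFilt (C.val x) (C.val_const_le_one x) 0 : Submodule k C.X.functionField) ≠ ⊤ := by
  let F := (Scheme.ΓSpecIso (.of k)).inv ≫ C.hom.appTop
  let : Algebra k Γ(C.X, ⊤) := F.hom.toAlgebra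
  have hF : F.hom.Finite := (finite_appTop_of_universallyClosed k C.hom).comp
    (RingHom.Finite.of_surjective _
      (ConcreteCategory.bijective_of_isIso (Scheme.ΓSpecIso (.of k)).inv).2)
  have : Module.Finite k Γ(C.X, ⊤) := hF
  let g : Γ(C.X, ⊤) →ₗ[k] C.X.functionField :=
    { toFun := fun s => C.X.presheaf.germ ⊤ (genericPoint C.X) trivial s
      map_add' := fun a b => map_add _ a b
      map_smul' := fun c a => by
        rw [Algebra.smul_def, map_mul, RingHom.id_apply, Algebra.smul_def]
        rfl }
  have hle : (⨅ x, valFilt (C.val x) (C.val_const_le_one x) 0) ≤ LinearMap.range g := by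
    intro f hf
    rw [Submodule.mem_iInf] at hf
    exact C.exists_section_of_regular f fun x => hf x
  refine ne_top_of_le_ne_top ?_
    (Module.length_le_of_injective _ (Submodule.inclusion_injective hle))
  exact Module.length_ne_top

theorem isProperPlaceFamily : IsProperPlaceFamily k C.val (fun x => C.pointDegree x.1) where
  const := C.val_const_le_one
  uniformizer _ := IsDedekindDomain.HeightOneSpectrum.valuation_exists_uniformizer _ _
  residue := C.length_residue
  finite := C.finite_val_ne_one
  incomparable := C.incomparable
  global := C.length_global

/-- A principal divisor on a smooth projective curve has degree zero. -/
theorem finsum_ord_mul_pointDegree (f : C.X.functionField) (hf : f ≠ 0) :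
    ∑ᶠ x : C.X, C.X.ord f x * (C.pointDegree x : ℤ) = 0 := by
  have h1 := C.isProperPlaceFamily.finsum_log_mul_eq_zero f hf
  have h2 : ∑ᶠ x : C.ClosedPoint, C.X.ord f x.1 * (C.pointDegree x.1 : ℤ) = 0 := by
    rw [← neg_eq_zero, ← finsum_neg_distrib, ← h1]
    refine finsum_congr fun x => ?_
    rw [C.ord_eq_neg_log_val]
    ring
  rw [← h2, finsum_subtype_eq_finsum_cond
    (f := fun x => C.X.ord f x * (C.pointDegree x : ℤ)) (· ≠ genericPoint C.X)]
  refine finsum_congr fun x => ?_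
  by_cases hx : x = genericPoint C.X
  · simp [hx, C.ord_genericPoint]
  · simp [hx]

end SmoothProjectiveCurve

/-! ### Stalks of sheaves of modules and exactness. -/

namespace AlgebraicGeometry.Scheme.Modules

open TopologicalSpace Opposite

variable {X : Scheme.{u}}

noncomputable instance (M : X.Modules) (x : X) :
    Module (X.presheaf.stalk x) (M.presheaf.stalk x) :=
  PresheafOfModules.instModuleCarrierStalkCommRingCatCarrierAbPresheafOpensCarrier
    (R := X.presheaf) M.val x

/-- The germ of a section. -/
noncomputable def germ (M : X.Modules) (U : X.Opens) (x : X) (hx : x ∈ U) :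
    Γ(M, U) →+ M.presheaf.stalk x :=
  (TopCat.Presheaf.germ M.presheaf U x hx).hom

lemma germ_smul (M : X.Modules) (U : X.Opens) (x : X) (hx : x ∈ U) (r : Γ(X, U)) (s : Γ(M, U)) :
    M.germ U x hx (r • s) = X.presheaf.germ U x hx r • M.germ U x hx s :=
  PresheafOfModules.germ_smul (R := X.presheaf) M.val x U hx r s

lemma germ_resSection (M : X.Modules) {U V : X.Opens} (h : V ≤ U) (x : X) (hx : x ∈ V)
    (s : Γ(M, U)) : M.germ V x hx (resSection M h s) = M.germ U x (h hx) s :=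
  TopCat.Presheaf.germ_res_apply M.presheaf (homOfLE h) x hx s

lemma resSection_smul (M : X.Modules) {U V : X.Opens} (h : V ≤ U) (r : Γ(X, U)) (s : Γ(M, U)) :
    resSection M h (r • s) = X.presheaf.map (homOfLE h).op r • resSection M h s :=
  M.map_smul _ _ _

lemma resSection_resSection (M : X.Modules) {U V W : X.Opens} (h : V ≤ U) (h' : W ≤ V)
    (s : Γ(M, U)) : resSection M h' (resSection M h s) = resSection M (h'.trans h) s := by
  simp only [resSection, ← ConcreteCategory.comp_apply, ← Functor.map_comp]
  rfl

lemma exists_germ_eq (M : X.Modules) {x : X} (m : M.presheaf.stalk x) :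
    ∃ (V : X.Opens) (hV : x ∈ V) (s : Γ(M, V)), M.germ V x hV s = m :=
  TopCat.Presheaf.exists_germ_eq M.presheaf m

lemma exists_le_germ_eq (M : X.Modules) {U : X.Opens} {x : X} (hx : x ∈ U)
    (m : M.presheaf.stalk x) :
    ∃ (V : X.Opens) (_ : V ≤ U) (hV : x ∈ V) (s : Γ(M, V)), M.germ V x hV s = m := by
  obtain ⟨V, i, hV, s, rfl⟩ := TopCat.Presheaf.exists_le_germ_eq M.presheaf m hx
  exact ⟨V, i, hV, s, rfl⟩

lemma exists_resSection_eq (M : X.Modules) {U : X.Opens} {x : X} (hx : x ∈ U) {s t : Γ(M, U)}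
    (h : M.germ U x hx s = M.germ U x hx t) :
    ∃ (V : X.Opens) (hVU : V ≤ U), x ∈ V ∧ resSection M hVU s = resSection M hVU t := by
  obtain ⟨V, hV, i, j, e⟩ := TopCat.Presheaf.germ_eq M.presheaf x hx hx s t h
  exact ⟨V, leOfHom i, hV, e⟩

lemma section_ext (M : X.Modules) {U : X.Opens} {s t : Γ(M, U)}
    (h : ∀ x (hx : x ∈ U), M.germ U x hx s = M.germ U x hx t) : s = t :=
  TopCat.Presheaf.section_ext ⟨M.presheaf, M.isSheaf⟩ U s t h

/-- The map induced on stalks by a morphism of sheaves of modules. -/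
noncomputable def stalkMap {M N : X.Modules} (f : M ⟶ N) (x : X) :
    M.presheaf.stalk x →ₗ[X.presheaf.stalk x] N.presheaf.stalk x where
  toFun := (TopCat.Presheaf.stalkFunctor Ab x).map f.mapPresheaf
  map_add' := map_add _
  map_smul' r m := by
    obtain ⟨U, hU, a, rfl⟩ := X.presheaf.exists_germ_eq r
    obtain ⟨V, hVU, hV, s, rfl⟩ := M.exists_le_germ_eq hU m
    rw [← X.presheaf.germ_res_apply (homOfLE hVU) x hV a, ← germ_smul]
    refine (TopCat.Presheaf.stalkFunctor_map_germ_apply V x hV f.mapPresheaf _).trans ?_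
    refine (congrArg (N.germ V x hV) (f.app_smul _ s)).trans ((N.germ_smul V x hV _ _).trans ?_)
    exact congrArg _ (TopCat.Presheaf.stalkFunctor_map_germ_apply V x hV f.mapPresheaf s).symm

lemma stalkMap_germ {M N : X.Modules} (f : M ⟶ N) (U : X.Opens) (x : X) (hx : x ∈ U)
    (s : Γ(M, U)) : stalkMap f x (M.germ U x hx s) = N.germ U x hx (f.app U s) :=
  TopCat.Presheaf.stalkFunctor_map_germ_apply U x hx f.mapPresheaf s

lemma stalkMap_comp_apply {M N P : X.Modules} (f : M ⟶ N) (g : N ⟶ P) (x : X)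
    (m : M.presheaf.stalk x) : stalkMap (f ≫ g) x m = stalkMap g x (stalkMap f x m) := by
  obtain ⟨U, hU, s, rfl⟩ := M.exists_germ_eq m
  rw [stalkMap_germ, stalkMap_germ, stalkMap_germ]
  rfl

lemma stalkMap_zero_apply {M N : X.Modules} (x : X)
    (m : M.presheaf.stalk x) : stalkMap (0 : M ⟶ N) x m = 0 := by
  obtain ⟨U, hU, s, rfl⟩ := M.exists_germ_eq m
  rw [stalkMap_germ]
  exact map_zero _

/-- Sections over `U`, as a module over the sections of the structure sheaf. -/
noncomputable def sectionsFunctor (U : X.Opens) : X.Modules ⥤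
    ModuleCat (X.ringCatSheaf.obj.obj (op U)) :=
  SheafOfModules.forget _ ⋙ PresheafOfModules.evaluation X.ringCatSheaf.obj (op U)

instance (U : X.Opens) : Limits.PreservesLimits (sectionsFunctor U) :=
  have : Limits.PreservesLimits (SheafOfModules.forget.{u} X.ringCatSheaf) :=
    (PresheafOfModules.sheafificationAdjunction.{u}
      (𝟙 X.ringCatSheaf.obj)).rightAdjoint_preservesLimits
  @Limits.comp_preservesLimits _ _ _ _ _ _ _ _ this inferInstance

instance (U : X.Opens) : (sectionsFunctor U).PreservesZeroMorphisms where
  map_zero _ _ := rfl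

lemma app_injective {M N : X.Modules} (f : M ⟶ N) [Mono f] (U : X.Opens) :
    Function.Injective (f.app U) := by
  have : Mono ((sectionsFunctor U).map f) := inferInstance
  exact (ModuleCat.mono_iff_injective _).mp this

lemma stalkMap_injective {M N : X.Modules} (f : M ⟶ N) [Mono f] (x : X) :
    Function.Injective (stalkMap f x) :=
  TopCat.Presheaf.stalkFunctor_map_injective_of_app_injective (f := f.mapPresheaf)
    (fun U => app_injective f U) x

lemma mono_of_stalkMap_injective {M N : X.Modules} (f : M ⟶ N)
    (h : ∀ x, Function.Injective (stalkMap f x)) : Mono f := by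
  refine (toPresheaf X).mono_of_mono_map ?_
  have (U : (Opens X)ᵒᵖ) : Mono (((toPresheaf X).map f).app U) := by
    refine (AddCommGrpCat.mono_iff_injective _).mpr fun s t e => ?_
    refine M.section_ext fun x hx => h x ?_
    refine (stalkMap_germ f U.unop x hx s).trans (.trans ?_ (stalkMap_germ f U.unop x hx t).symm)
    exact congrArg _ e
  exact NatTrans.mono_of_mono_app _

/-- Taking sections is left exact. -/
lemma exists_app_eq_of_exact {S : ShortComplex X.Modules} (hS : S.Exact) [Mono S.f] (U : X.Opens)
    (s : Γ(S.X₂, U)) (h : S.g.app U s = 0) : ∃ t : Γ(S.X₁, U), S.f.app U t = s := by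
  have := hS.map_of_mono_of_preservesKernel (sectionsFunctor U)
    inferInstance inferInstance
  exact (ShortComplex.moduleCat_exact_iff _).mp this s h

lemma exists_stalkMap_eq_of_exact {S : ShortComplex X.Modules} (hS : S.Exact) [Mono S.f] (x : X)
    (m : S.X₂.presheaf.stalk x) (h : stalkMap S.g x m = 0) : ∃ t, stalkMap S.f x t = m := by
  obtain ⟨U, hU, s, rfl⟩ := S.X₂.exists_germ_eq m
  rw [stalkMap_germ] at h
  obtain ⟨V, hVU, hV, e⟩ := S.X₃.exists_resSection_eq hU (h.trans (map_zero _).symm)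
  obtain ⟨t, ht⟩ := exists_app_eq_of_exact hS V (resSection S.X₂ hVU s) (by
    have e' := e.trans (map_zero (S.X₃.presheaf.map (homOfLE hVU).op).hom)
    rw [← e']
    exact ConcreteCategory.congr_hom (S.g.mapPresheaf.naturality (homOfLE hVU).op) s)
  refine ⟨S.X₁.germ V x hV t, ?_⟩
  rw [stalkMap_germ, ht, germ_resSection]

/-- An epimorphism of sheaves of modules is surjective on stalks. -/
lemma stalkMap_surjective {M N : X.Modules} (f : M ⟶ N) [Epi f] (x : X) :
    Function.Surjective (stalkMap f x) := by
  let F : M.val ⟶ N.val := (toPresheafOfModules X).map f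
  let adj : PresheafOfModules.sheafification (𝟙 X.ringCatSheaf.obj) ⊣ toPresheafOfModules X :=
    PresheafOfModules.sheafificationAdjunction (𝟙 X.ringCatSheaf.obj)
  let Q := Limits.cokernel F
  let q : N.val ⟶ Q := Limits.cokernel.π F
  -- Composed with f, the map from N to the sheafified presheaf cokernel is zero; as f is epi among
  -- sheaves, the map itself is zero.
  have hq : q ≫ adj.unit.app Q = 0 := by
    let A : X.Modules := (PresheafOfModules.sheafification (𝟙 X.ringCatSheaf.obj)).obj Q
    obtain ⟨g, hg⟩ := (toPresheafOfModules X).map_surjective (X := N) (Y := A)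
      (q ≫ adj.unit.app Q)
    have hfg : f ≫ g = 0 := by
      apply (toPresheafOfModules X).map_injective
      refine ((toPresheafOfModules X).map_comp f g).trans ?_
      rw [hg]
      have : F ≫ q = 0 := Limits.cokernel.condition F
      change F ≫ q ≫ _ = _
      rw [← Category.assoc, this, Limits.zero_comp]
      rfl
    have hg0 : g = 0 := (cancel_epi f).mp (hfg.trans (Limits.comp_zero (f := f)).symm)
    refine hg.symm.trans ?_
    rw [hg0]
    rfl
  intro m
  obtain ⟨U, hU, s, rfl⟩ := N.exists_germ_eq m
  have hs : (toSheafify (Opens.grothendieckTopology X) Q.presheaf).app (op U) (q.app (op U) s) =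
      (toSheafify (Opens.grothendieckTopology X) Q.presheaf).app (op U) 0 := by
    rw [map_zero]
    exact congrArg (fun φ => PresheafOfModules.Hom.app φ (op U) s) hq
  -- A section dying in the sheafification already dies locally in Q, so s locally lifts to M.
  obtain ⟨V, i, hi, hV⟩ := Presheaf.equalizerSieve_mem (Opens.grothendieckTopology X)
    (toSheafify (Opens.grothendieckTopology X) Q.presheaf) _ _ hs x hU
  have hex : (ShortComplex.mk F q (Limits.cokernel.condition F)).Exact :=
    ShortComplex.exact_cokernel F
  have hex' := hex.map_of_epi_of_preservesCokernel (PresheafOfModules.evaluation _ (op V))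
    inferInstance inferInstance
  obtain ⟨t, ht⟩ := (ShortComplex.moduleCat_exact_iff _).mp hex' (resSection N (leOfHom i) s) (by
    have h2 : Q.presheaf.map i.op (q.app (op U) s) = 0 := hi.trans (map_zero _)
    exact (PresheafOfModules.naturality_apply q i.op s).trans h2)
  refine ⟨M.germ V x hV t, ?_⟩
  refine (stalkMap_germ f V x hV t).trans (Eq.trans ?_ (germ_resSection N (leOfHom i) x hV s))
  exact congrArg _ ht

end AlgebraicGeometry.Scheme.Modules

/-! ### Frames, bases of stalks and the generic stalk. -/

section LinearAlgebra

variable {R S M N ι : Type*} [CommRing R] [CommRing S] [AddCommGroup M] [AddCommGroup N]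
  [Module R M] [Module S N]

/-- Determinants with respect to a basis are compatible with semilinear maps carrying it to a
basis. -/
lemma Module.Basis.map_det_of_semilinear [Fintype ι] [DecidableEq ι] (φ : R →+* S) (f : M →+ N)
    (hf : ∀ r m, f (r • m) = φ r • f m) (b : Module.Basis ι R M) (b' : Module.Basis ι S N)
    (hb : ∀ i, b' i = f (b i)) (v : ι → M) : φ (b.det v) = b'.det (f ∘ v) := by
  rw [Module.Basis.det_apply, Module.Basis.det_apply, RingHom.map_det]
  congr 1
  ext i j
  simp only [RingHom.mapMatrix_apply, Matrix.map_apply, Module.Basis.toMatrix_apply,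
    Function.comp_apply]
  have h : f (v j) = ∑ i, φ (b.repr (v j) i) • b' i := by
    conv_lhs => rw [← b.sum_repr (v j), map_sum]
    exact Finset.sum_congr rfl fun i _ => by rw [hf, hb]
  rw [h, b'.repr_sum_self]

/-- Linear independence is preserved and reflected by passage to the fraction field. -/
lemma linearIndependent_comp_iff_of_isFractionRing {K V : Type*} [Field K]
    [Algebra R K] [IsFractionRing R K] [AddCommGroup V] [Module K V]
    (f : M →+ V) (hf : ∀ r m, f (r • m) = algebraMap R K r • f m) (hinj : Function.Injective f)
    (v : ι → M) : LinearIndependent K (f ∘ v) ↔ LinearIndependent R v := by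
  let : Module R V := Module.compHom V (algebraMap R K)
  have : IsScalarTower R K V := ⟨fun r a w => by
    rw [Algebra.smul_def, mul_smul]; rfl⟩
  rw [← LinearIndependent.iff_fractionRing R K]
  let f' : M →ₗ[R] V := { f with map_smul' := hf }
  exact LinearMap.linearIndependent_iff_of_injOn f' (fun a _ b _ h => hinj h)

lemma injective_of_linearIndependent_basis (φ : R →+* S) (hφ : Function.Injective φ) (f : M →+ N)
    (hf : ∀ r m, f (r • m) = φ r • f m) (b : Module.Basis ι R M)
    (hb : LinearIndependent S (f ∘ b)) : Function.Injective f := by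
  rw [injective_iff_map_eq_zero]
  intro m hm
  rw [← b.repr.map_eq_zero_iff]
  ext i
  have h : f m = ∑ i ∈ (b.repr m).support, φ (b.repr m i) • (f ∘ b) i := by
    conv_lhs => rw [← b.linearCombination_repr m, Finsupp.linearCombination_apply, Finsupp.sum,
      map_sum]
    exact Finset.sum_congr rfl fun i _ => hf _ _
  by_cases hi : i ∈ (b.repr m).support
  · have := linearIndependent_iff'.mp hb _ _ (h.symm.trans hm) i hi
    exact hφ (this.trans (map_zero φ).symm)
  · simpa using hi

end LinearAlgebra

/-- Finitely many germs at a point are germs of sections over a common neighbourhood. -/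
lemma TopCat.Presheaf.exists_common_germ_eq {X : TopCat.{u}} {C : Type*} [Category.{u} C]
    [Limits.HasColimits C] {FC : C → C → Type*} {CC : C → Type u}
    [∀ X Y, FunLike (FC X Y) (CC X) (CC Y)] [ConcreteCategory C FC]
    [Limits.PreservesFilteredColimits (CategoryTheory.forget C)] (F : X.Presheaf C) {x : X}
    {U : TopologicalSpace.Opens X} (hx : x ∈ U) {ι : Type*} [Finite ι]
    (t : ι → ToType (F.stalk x)) :
    ∃ (V : TopologicalSpace.Opens X) (_ : V ≤ U) (hV : x ∈ V)
      (s : ι → ToType (F.obj (.op V))), ∀ i, F.germ V x hV (s i) = t i := by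
  have := Fintype.ofFinite ι
  choose V hVU hV s hs using fun i => F.exists_le_germ_eq (t i) hx
  have hmem : x ∈ U ⊓ Finset.univ.inf V := by
    refine ⟨hx, ?_⟩
    rw [SetLike.mem_coe, ← SetLike.mem_coe, TopologicalSpace.Opens.coe_finset_inf]
    simpa using hV
  have hle (i) : U ⊓ Finset.univ.inf V ≤ V i := inf_le_right.trans (Finset.inf_le (Finset.mem_univ i))
  refine ⟨_, inf_le_left, hmem, fun i => F.map (homOfLE (hle i)).op (s i), fun i => ?_⟩
  rw [TopCat.Presheaf.germ_res_apply, hs]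

section Frames

open Scheme.Modules TopologicalSpace Opposite

variable {X : Scheme.{u}} {M : X.Modules} {n : ℕ} {U : X.Opens} {s : Fin n → Γ(M, U)}

lemma IsFrame.basis_apply (hs : IsFrame M U s) {V : X.Opens} (h : V ≤ U) (i : Fin n) :
    hs.basis h i = resSection M h (s i) :=
  Module.Basis.mk_apply _ _ i

lemma IsFrame.germ_linearIndependent (hs : IsFrame M U s) {x : X} (hx : x ∈ U) :
    LinearIndependent (X.presheaf.stalk x) (fun i => M.germ U x hx (s i)) := by
  rw [Fintype.linearIndependent_iff]
  intro g hg i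
  obtain ⟨V, hVU, hV, r, hr⟩ := X.presheaf.exists_common_germ_eq hx g
  have h1 : M.germ V x hV (∑ i, r i • resSection M hVU (s i)) = M.germ V x hV 0 := by
    rw [map_sum, map_zero, ← hg]
    exact Finset.sum_congr rfl fun i _ => by rw [germ_smul, germ_resSection, hr]
  obtain ⟨W, hWV, hW, h2⟩ := M.exists_resSection_eq hV h1
  have h3 : ∑ i, X.presheaf.map (homOfLE hWV).op (r i) • resSection M (hWV.trans hVU) (s i) = 0 := by
    have h4 : resSection M hWV (∑ i, r i • resSection M hVU (s i)) = 0 := h2.trans (map_zero _)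
    rw [← h4, resSection, map_sum]
    refine Finset.sum_congr rfl fun i _ => ?_
    rw [← resSection_resSection M hVU hWV]
    exact (resSection_smul M hWV _ _).symm
  have h5 := Fintype.linearIndependent_iff.mp (hs.linearIndependent W _) _ h3 i
  rw [← hr, ← X.presheaf.germ_res_apply (homOfLE hWV) x hW, h5, map_zero]

lemma IsFrame.span_germ_eq_top (hs : IsFrame M U s) {x : X} (hx : x ∈ U) :
    Submodule.span (X.presheaf.stalk x) (Set.range fun i => M.germ U x hx (s i)) = ⊤ := by
  rw [eq_top_iff]
  intro m _
  obtain ⟨V, hVU, hV, t, rfl⟩ := M.exists_le_germ_eq hx m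
  rw [← (hs.basis hVU).sum_repr t, map_sum]
  refine Submodule.sum_mem _ fun i _ => ?_
  rw [germ_smul, hs.basis_apply, germ_resSection]
  exact Submodule.smul_mem _ _ (Submodule.subset_span ⟨i, rfl⟩)

/-- The basis of the stalk given by a frame. -/
noncomputable def IsFrame.stalkBasis (hs : IsFrame M U s) {x : X} (hx : x ∈ U) :
    Module.Basis (Fin n) (X.presheaf.stalk x) (M.presheaf.stalk x) :=
  Module.Basis.mk (hs.germ_linearIndependent hx) (hs.span_germ_eq_top hx).ge

lemma IsFrame.stalkBasis_apply (hs : IsFrame M U s) {x : X} (hx : x ∈ U) (i : Fin n) :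
    hs.stalkBasis hx i = M.germ U x hx (s i) :=
  Module.Basis.mk_apply _ _ i

lemma IsFrame.germ_det (hs : IsFrame M U s) {V : X.Opens} (h : V ≤ U) {x : X} (hx : x ∈ V)
    (v : Fin n → Γ(M, V)) :
    X.presheaf.germ V x hx ((hs.basis h).det v) =
      (hs.stalkBasis (h hx)).det (fun i => M.germ V x hx (v i)) := by
  refine Module.Basis.map_det_of_semilinear (X.presheaf.germ V x hx).hom
    (M.germ V x hx) (fun r m => M.germ_smul V x hx r m) _ _ (fun i => ?_) v
  rw [hs.basis_apply, hs.stalkBasis_apply, germ_resSection]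

/-- Sections whose germs are a basis of all stalks are a frame. -/
lemma isFrame_of_germ
    (hli : ∀ x (hx : x ∈ U),
      LinearIndependent (X.presheaf.stalk x) (fun i => M.germ U x hx (s i)))
    (hsp : ∀ x (hx : x ∈ U),
      Submodule.span (X.presheaf.stalk x) (Set.range fun i => M.germ U x hx (s i)) = ⊤) :
    IsFrame M U s := by
  have hli' (V : X.Opens) (h : V ≤ U) :
      LinearIndependent Γ(X, V) (fun i => resSection M h (s i)) := by
    rw [Fintype.linearIndependent_iff]
    intro g hg i
    refine TopCat.Presheaf.section_ext X.sheaf V _ _ fun x hx => ?_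
    have h1 : ∑ i, X.presheaf.germ V x hx (g i) • M.germ U x (h hx) (s i) = 0 := by
      rw [← map_zero (M.germ V x hx), ← hg, map_sum]
      exact Finset.sum_congr rfl fun i _ => by rw [germ_smul, germ_resSection]
    exact (Fintype.linearIndependent_iff.mp (hli x (h hx)) _ h1 i).trans (map_zero _).symm
  refine ⟨hli', fun V h => ?_⟩
  rw [eq_top_iff]
  intro m _
  have hloc (x : V) : ∃ (W : X.Opens) (hWV : W ≤ V) (_ : x.1 ∈ W) (r : Fin n → Γ(X, W)),
      ∑ i, r i • resSection M (hWV.trans h) (s i) = resSection M hWV m := by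
    obtain ⟨c, hc⟩ := (Submodule.mem_span_range_iff_exists_fun _).mp
      ((hsp x (h x.2)).ge (Submodule.mem_top (x := M.germ V x x.2 m)))
    obtain ⟨W, hWV, hW, r, hr⟩ := X.presheaf.exists_common_germ_eq x.2 c
    obtain ⟨W', hW', hxW', e⟩ := M.exists_resSection_eq hW
      (s := ∑ i, r i • resSection M (hWV.trans h) (s i)) (t := resSection M hWV m) (by
        rw [germ_resSection, ← hc, map_sum]
        exact Finset.sum_congr rfl fun i _ => by rw [germ_smul, germ_resSection, hr])
    refine ⟨W', hW'.trans hWV, hxW', fun i => X.presheaf.map (homOfLE hW').op (r i), ?_⟩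
    rw [← resSection_resSection M hWV hW', ← e, resSection, map_sum]
    refine Finset.sum_congr rfl fun i _ => ?_
    rw [← resSection_resSection M (hWV.trans h) hW']
    exact (resSection_smul M hW' _ _).symm
  choose W hWV hW r hr using hloc
  -- Coefficients exist locally; linear independence makes them unique, so they agree on overlaps.
  have hglue (i : Fin n) : ∃ a : Γ(X, V), ∀ x, X.presheaf.map (homOfLE (hWV x)).op a = r x i := by
    refine (X.sheaf.existsUnique_gluing' W V (fun x => homOfLE (hWV x))
      (fun x hx => Opens.mem_iSup.mpr ⟨⟨x, hx⟩, hW _⟩) (fun x => r x i) ?_).exists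
    intro x y
    have key (z : V) (h' : W x ⊓ W y ≤ W z) :
        ∑ i, X.presheaf.map (homOfLE h').op (r z i) •
          resSection M ((h'.trans (hWV z)).trans h) (s i) =
          resSection M (h'.trans (hWV z)) m := by
      rw [← resSection_resSection M (hWV z) h', ← hr z, resSection, map_sum]
      refine Finset.sum_congr rfl fun i _ => ?_
      rw [← resSection_resSection M ((hWV z).trans h) h']
      exact (resSection_smul M h' _ _).symm
    have h1 := (key x inf_le_left).trans (key y inf_le_right).symm
    have h2 := Fintype.linearIndependent_iff.mp (hli' (W x ⊓ W y) ((inf_le_left.trans (hWV x)).trans h))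
      (fun i => X.presheaf.map (homOfLE inf_le_left).op (r x i) -
        X.presheaf.map (homOfLE inf_le_right).op (r y i)) (by
        simp only [sub_smul, Finset.sum_sub_distrib]
        exact sub_eq_zero.mpr h1) i
    exact sub_eq_zero.mp h2
  choose a ha using hglue
  have hm : m = ∑ i, a i • resSection M h (s i) := by
    refine M.section_ext fun x hx => ?_
    rw [← germ_resSection M (hWV ⟨x, hx⟩) x (hW _), ← hr, map_sum, map_sum]
    refine Finset.sum_congr rfl fun i _ => ?_
    rw [germ_smul, germ_smul, germ_resSection, germ_resSection, ← ha,
      TopCat.Presheaf.germ_res_apply]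
  rw [hm]
  exact Submodule.sum_mem _ fun i _ =>
    Submodule.smul_mem _ _ (Submodule.subset_span ⟨i, rfl⟩)

/-- A basis of a stalk spreads out. -/
lemma IsFrame.exists_spread (hs : IsFrame M U s) {x : X} (hx : x ∈ U) {ι : Type*} [Finite ι]
    (b : Module.Basis ι (X.presheaf.stalk x) (M.presheaf.stalk x)) :
    ∃ (W : X.Opens) (hW : x ∈ W) (t : ι → Γ(M, W)), (∀ i, M.germ W x hW (t i) = b i) ∧
      ∀ y (hy : y ∈ W), LinearIndependent (X.presheaf.stalk y) (fun i => M.germ W y hy (t i)) ∧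
        Submodule.span (X.presheaf.stalk y) (Set.range fun i => M.germ W y hy (t i)) = ⊤ := by
  let e : ι ≃ Fin n := b.indexEquiv (hs.stalkBasis hx)
  obtain ⟨V, hVU, hV, t, ht⟩ := TopCat.Presheaf.exists_common_germ_eq M.presheaf hx b
  -- The lifted sections form a basis exactly where this determinant is a unit, so its basic open
  -- set is the required neighbourhood.
  let d : Γ(X, V) := (hs.basis hVU).det (t ∘ e.symm)
  have hle : X.basicOpen d ≤ V := X.basicOpen_le d
  have hd : x ∈ X.basicOpen d := by
    rw [X.mem_basicOpen d x hV, hs.germ_det]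
    convert! (hs.stalkBasis hx).isUnit_det (b.reindex e) using 2
    ext i
    rw [Module.Basis.reindex_apply]
    exact ht _
  refine ⟨X.basicOpen d, hd, fun i => resSection M hle (t i), fun i => ?_, fun y hy => ?_⟩
  · rw [germ_resSection]
    exact ht i
  · have h1 := (X.mem_basicOpen d y (hle hy)).mp hy
    rw [hs.germ_det, ← Module.Basis.is_basis_iff_det] at h1
    simp only [germ_resSection]
    refine ⟨(linearIndependent_equiv e.symm).mp h1.1, ?_⟩
    rw [← h1.2, ← e.symm.surjective.range_comp]
    rfl

end Frames

namespace AlgebraicGeometry.Scheme.Modules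

variable {X : Scheme.{u}} [IsIntegral X] (M : X.Modules) (x : X)

/-- The map from a stalk to the generic stalk. -/
noncomputable def toGenericStalk : M.presheaf.stalk x →+ M.presheaf.stalk (genericPoint X) :=
  (TopCat.Presheaf.stalkSpecializes M.presheaf ((genericPoint_spec X).specializes trivial)).hom

lemma toGenericStalk_germ (U : X.Opens) (hx : x ∈ U) (hη : genericPoint X ∈ U) (s : Γ(M, U)) :
    M.toGenericStalk x (M.germ U x hx s) = M.germ U (genericPoint X) hη s :=
  ConcreteCategory.congr_hom (TopCat.Presheaf.germ_stalkSpecializes M.presheaf hx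
    ((genericPoint_spec X).specializes trivial)) s

lemma genericPoint_mem {X : Scheme.{u}} [IrreducibleSpace X] {U : X.Opens} {x : X} (hx : x ∈ U) :
    genericPoint X ∈ U :=
  ((genericPoint_spec X).mem_open_set_iff U.isOpen).mpr ⟨x, Set.mem_univ _, hx⟩

lemma toGenericStalk_smul (r : X.presheaf.stalk x) (m : M.presheaf.stalk x) :
    M.toGenericStalk x (r • m) =
      algebraMap (X.presheaf.stalk x) X.functionField r • M.toGenericStalk x m := by
  obtain ⟨U, hU, a, rfl⟩ := X.presheaf.exists_germ_eq r
  obtain ⟨V, hVU, hV, s, rfl⟩ := M.exists_le_germ_eq hU m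
  have : Nonempty V := ⟨⟨x, hV⟩⟩
  rw [← X.presheaf.germ_res_apply (homOfLE hVU) x hV a, ← germ_smul,
    toGenericStalk_germ _ _ _ _ (genericPoint_mem hV), germ_smul,
    toGenericStalk_germ _ _ _ _ (genericPoint_mem hV),
    Scheme.algebraMap_germ_eq_germToFunctionField]

lemma stalkMap_toGenericStalk {M N : X.Modules} (f : M ⟶ N) (x : X) (m : M.presheaf.stalk x) :
    stalkMap f (genericPoint X) (M.toGenericStalk x m) = N.toGenericStalk x (stalkMap f x m) := by
  obtain ⟨U, hU, s, rfl⟩ := M.exists_germ_eq m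
  rw [toGenericStalk_germ _ _ _ _ (genericPoint_mem hU), stalkMap_germ, stalkMap_germ,
    toGenericStalk_germ _ _ _ _ (genericPoint_mem hU)]

end AlgebraicGeometry.Scheme.Modules

namespace CurveBundle

open Scheme.Modules

variable {k : Type u} [Field k] {C : SmoothProjectiveCurve k}

lemma genericPoint_mem_nhd (E : CurveBundle C) (x : C.X) : genericPoint C.X ∈ E.nhd x :=
  genericPoint_mem (E.mem_nhd x)

/-- The basis of the stalk at `x` given by the chosen frame. -/
noncomputable def stalkBasis (E : CurveBundle C) (x : C.X) :
    Module.Basis (Fin E.rank) (C.X.presheaf.stalk x) (E.sheaf.presheaf.stalk x) :=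
  (E.isFrame_frame x).stalkBasis (E.mem_nhd x)

/-- The basis of the generic stalk given by the frame chosen at `x`. -/
noncomputable def genericBasis (E : CurveBundle C) (x : C.X) :
    Module.Basis (Fin E.rank) C.X.functionField (E.sheaf.presheaf.stalk (genericPoint C.X)) :=
  (E.isFrame_frame x).stalkBasis (E.genericPoint_mem_nhd x)

lemma genericBasis_apply (E : CurveBundle C) (x : C.X) (i : Fin E.rank) :
    E.genericBasis x i = E.sheaf.toGenericStalk x (E.stalkBasis x i) := by
  rw [stalkBasis, genericBasis, IsFrame.stalkBasis_apply, IsFrame.stalkBasis_apply,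
    toGenericStalk_germ]

lemma toGenericStalk_injective (E : CurveBundle C) (x : C.X) :
    Function.Injective (E.sheaf.toGenericStalk x) := by
  refine injective_of_linearIndependent_basis (algebraMap (C.X.presheaf.stalk x) C.X.functionField)
    (IsFractionRing.injective _ _) _ (toGenericStalk_smul _ _) (E.stalkBasis x) ?_
  convert! (E.genericBasis x).linearIndependent using 1
  ext i
  exact (E.genericBasis_apply x i).symm

lemma linearIndependent_toGenericStalk_iff (E : CurveBundle C) (x : C.X) {ι : Type*}
    (v : ι → E.sheaf.presheaf.stalk x) :
    LinearIndependent C.X.functionField (E.sheaf.toGenericStalk x ∘ v) ↔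
      LinearIndependent (C.X.presheaf.stalk x) v :=
  linearIndependent_comp_iff_of_isFractionRing _ (toGenericStalk_smul _ _)
    (E.toGenericStalk_injective x) v

lemma finrank_genericStalk (E : CurveBundle C) :
    Module.finrank C.X.functionField (E.sheaf.presheaf.stalk (genericPoint C.X)) = E.rank := by
  rw [Module.finrank_eq_card_basis (E.genericBasis (genericPoint C.X)), Fintype.card_fin]

instance (E : CurveBundle C) :
    Module.Finite C.X.functionField (E.sheaf.presheaf.stalk (genericPoint C.X)) :=
  .of_basis (E.genericBasis (genericPoint C.X))

/-- A locally free sheaf is a vector bundle, the local ranks being equal. -/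
noncomputable def ofExistsFrame (M : C.X.Modules) (h : ∀ x : C.X, ∃ U : C.X.Opens, x ∈ U ∧
    ∃ (n : ℕ) (s : Fin n → Γ(M, U)), IsFrame M U s) : CurveBundle C where
  sheaf := M
  rank := Module.finrank C.X.functionField (M.presheaf.stalk (genericPoint C.X))
  exists_frame x := by
    obtain ⟨U, hx, n, s, hs⟩ := h x
    have : Module.finrank C.X.functionField (M.presheaf.stalk (genericPoint C.X)) = n := by
      rw [Module.finrank_eq_card_basis (R := C.X.functionField)
        (hs.stalkBasis (genericPoint_mem hx)), Fintype.card_fin]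
    rw [this]
    exact ⟨U, hx, s, hs⟩

end CurveBundle

/-! ### Kernels and images of bundle maps. -/

section LinearAlgebra

variable {R A B D α β : Type*} [CommRing R] [AddCommGroup A] [AddCommGroup B] [AddCommGroup D]
  [Module R A] [Module R B] [Module R D]

lemma linearIndependent_of_map_eq_inl {i : A →ₗ[R] B} {g : α ⊕ β → B} {a : α → A}
    (hg : LinearIndependent R g) (ha : ∀ s, i (a s) = g (.inl s)) :
    LinearIndependent R a := by
  apply LinearIndependent.of_comp i
  convert! hg.comp _ Sum.inl_injective using 1
  ext s
  exact ha s

variable [Fintype α] [Fintype β]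

lemma linearIndependent_sumElim_of_exact {i : A →ₗ[R] B} {p : B →ₗ[R] D}
    (hi : Function.Injective i) (hpi : ∀ a, p (i a) = 0) {a : α → A} {b : β → B}
    (ha : LinearIndependent R a) (hb : LinearIndependent R (p ∘ b)) :
    LinearIndependent R (Sum.elim (i ∘ a) b) := by
  rw [Fintype.linearIndependent_iff] at *
  intro g hg
  simp only [Fintype.sum_sum_type, Sum.elim_inl, Sum.elim_inr, Function.comp_apply] at hg
  have h1 : ∀ j, g (.inr j) = 0 := hb _ (by
    have := congrArg p hg
    simpa [map_sum, hpi] using this)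
  have h2 : ∀ j, g (.inl j) = 0 := ha _ (by
    apply hi
    simpa [map_sum, h1] using hg)
  rintro (j | j)
  · exact h2 j
  · exact h1 j

lemma span_sumElim_eq_top_of_exact {i : A →ₗ[R] B} {p : B →ₗ[R] D}
    (hex : ∀ b, p b = 0 → ∃ a, i a = b) {a : α → A} {b : β → B}
    (ha : Submodule.span R (Set.range a) = ⊤) (hb : Submodule.span R (Set.range (p ∘ b)) = ⊤) :
    Submodule.span R (Set.range (Sum.elim (i ∘ a) b)) = ⊤ := by
  rw [eq_top_iff]
  intro m _
  obtain ⟨c, hc⟩ := (Submodule.mem_span_range_iff_exists_fun R).mp (hb.ge (Submodule.mem_top (x := p m)))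
  obtain ⟨m', hm'⟩ := hex (m - ∑ j, c j • b j) (by simpa [sub_eq_zero] using hc.symm)
  obtain ⟨c', hc'⟩ := (Submodule.mem_span_range_iff_exists_fun R).mp
    (ha.ge (Submodule.mem_top (x := m')))
  refine (Submodule.mem_span_range_iff_exists_fun R).mpr ⟨Sum.elim c' c, ?_⟩
  rw [Fintype.sum_sum_type]
  simp only [Sum.elim_inl, Sum.elim_inr, Function.comp_apply]
  have hm : i m' + ∑ j, c j • b j = m := by rw [hm', sub_add_cancel]
  rw [← hm, ← hc']
  simp

variable {i : A →ₗ[R] B} {p : B →ₗ[R] D} {g : α ⊕ β → B} {a : α → A}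

lemma span_eq_top_of_map_eq_inl (hi : Function.Injective i) (hpi : ∀ a, p (i a) = 0)
    (hgs : Submodule.span R (Set.range g) = ⊤) (ha : ∀ s, i (a s) = g (.inl s))
    (hr : LinearIndependent R fun t => p (g (.inr t))) :
    Submodule.span R (Set.range a) = ⊤ := by
  rw [eq_top_iff]
  intro m _
  obtain ⟨c, hc⟩ := (Submodule.mem_span_range_iff_exists_fun R).mp
    (hgs.ge (Submodule.mem_top (x := i m)))
  rw [Fintype.sum_sum_type] at hc
  have h0 := congrArg p hc
  simp only [map_add, map_sum, map_smul, ← ha, hpi, smul_zero, Finset.sum_const_zero,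
    zero_add] at h0
  have h1 := Fintype.linearIndependent_iff.mp hr _ h0
  refine (Submodule.mem_span_range_iff_exists_fun R).mpr ⟨fun s => c (.inl s), hi ?_⟩
  rw [← hc]
  simp [h1, ha]

lemma span_map_inr_eq_top (hp : Function.Surjective p) (hpi : ∀ s, p (g (.inl s)) = 0)
    (hgs : Submodule.span R (Set.range g) = ⊤) :
    Submodule.span R (Set.range fun t => p (g (.inr t))) = ⊤ := by
  rw [eq_top_iff]
  intro m _
  obtain ⟨m, rfl⟩ := hp m
  obtain ⟨c, rfl⟩ := (Submodule.mem_span_range_iff_exists_fun R).mp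
    (hgs.ge (Submodule.mem_top (x := m)))
  refine (Submodule.mem_span_range_iff_exists_fun R).mpr ⟨fun s => c (.inr s), ?_⟩
  simp [Fintype.sum_sum_type, hpi]

end LinearAlgebra

namespace CurveBundle

open Scheme.Modules Limits

variable {k : Type u} [Field k] {C : SmoothProjectiveCurve k} {E F : CurveBundle C}

/-- Near every point there is a frame of `E`, part of which spans the kernel of `f`, while the rest
is mapped to linearly independent sections. -/
lemma exists_adapted_frame (f : E.sheaf ⟶ F.sheaf) (x : C.X) :
    ∃ (a b : ℕ) (W : C.X.Opens) (_ : x ∈ W) (t : Fin a ⊕ Fin b → Γ(E.sheaf, W)),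
      (∀ y (hy : y ∈ W), LinearIndependent (C.X.presheaf.stalk y)
        (fun i => E.sheaf.germ W y hy (t i))) ∧
      (∀ y (hy : y ∈ W), Submodule.span (C.X.presheaf.stalk y)
        (Set.range fun i => E.sheaf.germ W y hy (t i)) = ⊤) ∧
      (∀ i, f.app W (t (.inl i)) = 0) ∧
      ∀ y (hy : y ∈ W), LinearIndependent (C.X.presheaf.stalk y)
        (fun i => stalkMap f y (E.sheaf.germ W y hy (t (.inr i)))) := by
  have := C.isPrincipalIdealRing_stalk x
  have := Module.Free.of_basis (E.stalkBasis x)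
  have := Module.Finite.of_basis (E.stalkBasis x)
  have := Module.Free.of_basis (F.stalkBasis x)
  let g := stalkMap f x
  -- The stalk is a principal ideal ring, so kernel and range are free and the stalk of E splits as
  -- the kernel plus a lift of the range.
  let κ := Module.finBasis (C.X.presheaf.stalk x) (LinearMap.ker g)
  let ρ := Module.finBasis (C.X.presheaf.stalk x) (LinearMap.range g)
  choose l hl using fun i => LinearMap.surjective_rangeRestrict g (ρ i)
  have hρ : LinearIndependent (C.X.presheaf.stalk x) (g.rangeRestrict ∘ l) := by
    convert! ρ.linearIndependent using 1
    ext1 i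
    exact hl i
  have hli := linearIndependent_sumElim_of_exact (i := (LinearMap.ker g).subtype)
    (p := g.rangeRestrict) Subtype.val_injective (fun a => Subtype.ext a.2) κ.linearIndependent hρ
  have hspan := span_sumElim_eq_top_of_exact (i := (LinearMap.ker g).subtype)
    (p := g.rangeRestrict) (b := l)
    (fun b hb => ⟨⟨b, congrArg Subtype.val hb⟩, rfl⟩) κ.span_eq (by
      convert! ρ.span_eq using 3
      ext1 i
      exact hl i)
  let B := Module.Basis.mk hli hspan.ge
  obtain ⟨W, hW, t, ht, hW'⟩ := (E.isFrame_frame x).exists_spread (E.mem_nhd x) B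
  have hη := genericPoint_mem hW
  refine ⟨_, _, W, hW, t, fun y hy => (hW' y hy).1, fun y hy => (hW' y hy).2, fun i => ?_,
    fun y hy => ?_⟩
  -- Stalks of F embed in the generic stalk, so vanishing at x forces vanishing on all of W.
  · refine F.sheaf.section_ext fun y hy => F.toGenericStalk_injective y ?_
    rw [toGenericStalk_germ _ _ _ _ hη, map_zero, map_zero,
      ← toGenericStalk_germ _ x _ hW, ← stalkMap_germ, ht]
    have : stalkMap f x (B (.inl i)) = 0 := by
      rw [Module.Basis.mk_apply]
      exact (κ i).2
    rw [this, map_zero]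
  -- Independence at any point of W is equivalent to independence in the generic stalk, and so
  -- passes from x to every y.
  · have key (y) (hy : y ∈ W) : LinearIndependent (C.X.presheaf.stalk y)
        (fun i => stalkMap f y (E.sheaf.germ W y hy (t (.inr i)))) ↔
        LinearIndependent C.X.functionField
          (fun i => F.sheaf.germ W _ hη (f.app W (t (.inr i)))) := by
      rw [← linearIndependent_toGenericStalk_iff]
      have h : F.sheaf.toGenericStalk y ∘ (fun i =>
          stalkMap f y (E.sheaf.germ W y hy (t (.inr i)))) =
          fun i => F.sheaf.germ W _ hη (f.app W (t (.inr i))) := by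
        ext1 i
        simp only [Function.comp_apply]
        rw [stalkMap_germ, toGenericStalk_germ _ _ _ _ hη]
      rw [h]
    rw [key, ← key x hW]
    convert! hρ.map' (LinearMap.range g).subtype (Submodule.ker_subtype _) using 1
    ext1 i
    rw [ht, Module.Basis.mk_apply]
    rfl

lemma exists_frame_kernel (f : E.sheaf ⟶ F.sheaf) (x : C.X) :
    ∃ U : C.X.Opens, x ∈ U ∧ ∃ (n : ℕ) (s : Fin n → Γ(kernel f, U)), IsFrame (kernel f) U s := by
  obtain ⟨a, b, W, hW, t, h1, h2, h3, h4⟩ := exists_adapted_frame f x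
  have hex : (ShortComplex.mk (kernel.ι f) f (kernel.condition f)).Exact :=
    ShortComplex.exact_kernel f
  choose s hs using fun i => exists_app_eq_of_exact hex W (t (.inl i)) (h3 i)
  have hs' (y) (hy : y ∈ W) (i) : stalkMap (kernel.ι f) y ((kernel f).germ W y hy (s i)) =
      E.sheaf.germ W y hy (t (.inl i)) := by
    rw [stalkMap_germ]
    exact congrArg _ (hs i)
  refine ⟨W, hW, a, s, isFrame_of_germ (fun y hy => ?_) fun y hy => ?_⟩
  · exact linearIndependent_of_map_eq_inl (h1 y hy) (hs' y hy)
  · refine span_eq_top_of_map_eq_inl (p := stalkMap f y) (stalkMap_injective (kernel.ι f) y)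
      (fun m => ?_) (h2 y hy) (hs' y hy) (h4 y hy)
    rw [← stalkMap_comp_apply, kernel.condition, stalkMap_zero_apply]

/-- The complementary part of an adapted frame maps to a frame of the image, although it need not
extend to a frame of F: the image need not be saturated. -/
lemma exists_frame_image (f : E.sheaf ⟶ F.sheaf) (x : C.X) :
    ∃ U : C.X.Opens, x ∈ U ∧ ∃ (n : ℕ) (s : Fin n → Γ(image f, U)), IsFrame (image f) U s := by
  obtain ⟨a, b, W, hW, t, h1, h2, h3, h4⟩ := exists_adapted_frame f x
  refine ⟨W, hW, b, fun i => (factorThruImage f).app W (t (.inr i)),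
    isFrame_of_germ (fun y hy => ?_) fun y hy => ?_⟩
  · apply LinearIndependent.of_comp (stalkMap (image.ι f) y)
    convert! h4 y hy using 1
    ext1 i
    simp only [Function.comp_apply]
    rw [← stalkMap_germ, ← stalkMap_comp_apply, image.fac]
  · simp only [← stalkMap_germ]
    refine span_map_inr_eq_top (g := fun i => E.sheaf.germ W y hy (t i))
      (stalkMap_surjective (factorThruImage f) y) (fun i => ?_) (h2 y hy)
    apply stalkMap_injective (image.ι f) y
    rw [← stalkMap_comp_apply, image.fac, stalkMap_germ, h3, map_zero, map_zero]

/-- The kernel of a morphism of vector bundles on a curve. -/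
noncomputable def kernelBundle (f : E.sheaf ⟶ F.sheaf) : CurveBundle C :=
  ofExistsFrame (kernel f) (exists_frame_kernel f)

/-- The image of a morphism of vector bundles on a curve. -/
noncomputable def imageBundle (f : E.sheaf ⟶ F.sheaf) : CurveBundle C :=
  ofExistsFrame (image f) (exists_frame_image f)

lemma shortExact_kernel_image (f : E.sheaf ⟶ F.sheaf) :
    ∃ w : kernel.ι f ≫ factorThruImage f = 0,
      (ShortComplex.mk (kernel.ι f) (factorThruImage f) w).ShortExact := by
  have w : kernel.ι f ≫ factorThruImage f = 0 := by
    rw [← cancel_mono (image.ι f), Category.assoc, image.fac, kernel.condition, zero_comp]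
  refine ⟨w, .mk' ?_ inferInstance inferInstance⟩
  let φ : ShortComplex.mk (kernel.ι f) (factorThruImage f) w ⟶
      ShortComplex.mk (kernel.ι f) f (kernel.condition f) :=
    { τ₁ := 𝟙 _, τ₂ := 𝟙 _, τ₃ := image.ι f }
  have : Epi φ.τ₁ := inferInstanceAs (Epi (𝟙 _))
  have : IsIso φ.τ₂ := inferInstanceAs (IsIso (𝟙 _))
  have : Mono φ.τ₃ := inferInstanceAs (Mono (image.ι f))
  exact (ShortComplex.exact_iff_of_epi_of_isIso_of_mono φ).mpr (ShortComplex.exact_kernel f)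

end CurveBundle

/-! ### Additivity of rank and degree. -/

/-- The determinant of a base change adapted to an exact sequence. -/
lemma Module.Basis.det_eq_mul_of_exact {R A B D α β : Type*} [CommRing R] [AddCommGroup A]
    [AddCommGroup B] [AddCommGroup D] [Module R A] [Module R B] [Module R D] [Fintype α]
    [Fintype β] [DecidableEq α] [DecidableEq β] {i : A →ₗ[R] B} {p : B →ₗ[R] D}
    (hpi : ∀ a, p (i a) = 0) {u u' : Module.Basis α R A} {w w' : Module.Basis β R D}
    {b b' : Module.Basis (α ⊕ β) R B} (hu : ∀ s, b (.inl s) = i (u s))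
    (hu' : ∀ s, b' (.inl s) = i (u' s)) (hw : ∀ t, p (b (.inr t)) = w t)
    (hw' : ∀ t, p (b' (.inr t)) = w' t) : b.det b' = u.det u' * w.det w' := by
  have h1 (a : A) : b.repr (i a) = Finsupp.equivFunOnFinite.symm (Sum.elim (u.repr a) 0) := by
    apply b.repr.symm.injective
    rw [LinearEquiv.symm_apply_apply, b.repr_symm_apply, Finsupp.linearCombination_apply,
      Finsupp.sum_fintype _ _ (by simp), Fintype.sum_sum_type]
    conv_lhs => rw [← u.sum_repr a, map_sum]
    simp [hu]
  have h2 (m : B) (t : β) : w.repr (p m) t = b.repr m (.inr t) := by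
    have : p m = ∑ t, b.repr m (.inr t) • w t := by
      conv_lhs => rw [← b.sum_repr m, Fintype.sum_sum_type]
      simp only [map_add, map_sum, map_smul, hu, hpi, hw, smul_zero, Finset.sum_const_zero,
        zero_add]
    rw [this, w.repr_sum_self]
  have h3 : b.toMatrix b' = Matrix.fromBlocks (u.toMatrix u')
      (.of fun s t => b.repr (b' (.inr t)) (.inl s)) 0 (w.toMatrix w') := by
    ext (s | s) (t | t)
    · simp [Module.Basis.toMatrix_apply, hu', h1]
    · simp [Module.Basis.toMatrix_apply]
    · simp [Module.Basis.toMatrix_apply, hu', h1]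
    · simp [Module.Basis.toMatrix_apply, ← h2, hw']
  rw [Module.Basis.det_apply, h3, Matrix.det_fromBlocks_zero₂₁, Module.Basis.det_apply,
    Module.Basis.det_apply]

lemma SmoothProjectiveCurve.ord_algebraMap_of_isUnit {k : Type u} [Field k]
    (C : SmoothProjectiveCurve k) (x : C.X) {a : C.X.presheaf.stalk x} (ha : IsUnit a) :
    C.X.ord (algebraMap _ C.X.functionField a) x = 0 := by
  by_cases hx : x = genericPoint C.X
  · subst hx
    exact C.ord_genericPoint _
  · have h := C.ord_eq_neg_log_val ⟨x, hx⟩ (algebraMap _ C.X.functionField a)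
    have h1 : C.val ⟨x, hx⟩ (algebraMap _ C.X.functionField a) = 1 := by
      refine _root_.le_antisymm (C.val_algebraMap_le_one ⟨x, hx⟩ a) (not_lt.mp fun h => ?_)
      exact (IsLocalRing.mem_maximalIdeal _).mp
        ((C.val_algebraMap_lt_one_iff ⟨x, hx⟩ a).mp h) ha
    rw [h, h1, WithZero.log_one, neg_zero]

lemma SmoothProjectiveCurve.finite_support_ord {k : Type u} [Field k]
    (C : SmoothProjectiveCurve k) {f : C.X.functionField} (hf : f ≠ 0) :
    (Function.support fun x : C.X => C.X.ord f x * (C.pointDegree x : ℤ)).Finite := by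
  refine ((C.finite_val_ne_one f hf).image Subtype.val).subset fun x hx => ?_
  have hx1 : C.X.ord f x ≠ 0 := left_ne_zero_of_mul hx
  have hx2 : x ≠ genericPoint C.X := by
    rintro rfl
    exact hx1 (C.ord_genericPoint f)
  refine ⟨⟨x, hx2⟩, fun h => hx1 ?_, rfl⟩
  rw [C.ord_eq_neg_log_val ⟨x, hx2⟩, h, WithZero.log_one, neg_zero]

namespace CurveBundle

open Scheme.Modules

variable {k : Type u} [Field k] {C : SmoothProjectiveCurve k}

lemma detTransition_eq_det (E : CurveBundle C) (x : C.X) :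
    E.detTransition x = (E.genericBasis x).det (E.genericBasis (genericPoint C.X)) := by
  have := (E.isFrame_frame x).germ_det (V := E.nhd (genericPoint C.X) ⊓ E.nhd x) inf_le_right
    (x := genericPoint C.X) ⟨E.mem_nhd _, E.genericPoint_mem_nhd x⟩
    (fun i => resSection E.sheaf inf_le_left (E.frame (genericPoint C.X) i))
  refine this.trans (congrArg (E.genericBasis x).det ?_)
  ext i
  refine (germ_resSection E.sheaf inf_le_left _ _ _).trans ?_
  exact ((E.isFrame_frame _).stalkBasis_apply (E.genericPoint_mem_nhd _) i).symm

/-- Two bases of the stalk at x differ by a unit, so the order at x does not depend on the local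
frame. -/
lemma ord_det_eq_zero (E : CurveBundle C) (x : C.X)
    (b : Module.Basis (Fin E.rank) (C.X.presheaf.stalk x) (E.sheaf.presheaf.stalk x)) :
    C.X.ord ((E.genericBasis x).det (E.sheaf.toGenericStalk x ∘ b)) x = 0 := by
  rw [← Module.Basis.map_det_of_semilinear
    (algebraMap (C.X.presheaf.stalk x) C.X.functionField) _ (toGenericStalk_smul _ _)
    (E.stalkBasis x) (E.genericBasis x) (E.genericBasis_apply x)]
  exact C.ord_algebraMap_of_isUnit x ((E.stalkBasis x).isUnit_det b)

/-- On the neighbourhood where the generically chosen frame lives, that frame is itself a local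
basis; only finitely many points lie outside. -/
lemma finite_support (E : CurveBundle C) :
    (Function.support fun x : C.X =>
      C.X.ord (E.detTransition x) x * (C.pointDegree x : ℤ)).Finite := by
  refine (C.finite_compl _ (E.mem_nhd (genericPoint C.X))).subset fun x hx hmem => hx ?_
  have h := E.ord_det_eq_zero x ((E.isFrame_frame (genericPoint C.X)).stalkBasis hmem)
  have h2 : E.sheaf.toGenericStalk x ∘ ((E.isFrame_frame (genericPoint C.X)).stalkBasis hmem) =
      E.genericBasis (genericPoint C.X) := by
    ext i
    rw [Function.comp_apply, IsFrame.stalkBasis_apply,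
      toGenericStalk_germ _ _ _ _ (E.mem_nhd (genericPoint C.X))]
    exact ((E.isFrame_frame _).stalkBasis_apply (E.genericPoint_mem_nhd _) i).symm
  rw [h2, ← detTransition_eq_det] at h
  simp only [h, zero_mul]

lemma degree_eq_zero (E : CurveBundle C) (h : E.rank = 0) : E.degree = 0 := by
  have : IsEmpty (Fin E.rank) := by rw [h]; infer_instance
  rw [degree]
  refine finsum_eq_zero_of_forall_eq_zero fun x => ?_
  have h1 : E.detTransition x = algebraMap (C.X.presheaf.stalk x) C.X.functionField 1 := by
    rw [detTransition_eq_det, Module.Basis.det_apply, Matrix.det_isEmpty, map_one]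
  rw [h1, C.ord_algebraMap_of_isUnit x isUnit_one, zero_mul]

section ShortExact

variable {A E D : CurveBundle C} {i : A.sheaf ⟶ E.sheaf} {p : E.sheaf ⟶ D.sheaf} {w : i ≫ p = 0}

lemma rank_eq_add (hS : (ShortComplex.mk i p w).ShortExact) : E.rank = A.rank + D.rank := by
  have := hS.mono_f
  have := hS.epi_g
  have hi := stalkMap_injective i (genericPoint C.X)
  have hp := stalkMap_surjective p (genericPoint C.X)
  let i' : A.sheaf.presheaf.stalk (genericPoint C.X) →ₗ[C.X.functionField]
    E.sheaf.presheaf.stalk (genericPoint C.X) := stalkMap i (genericPoint C.X)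
  let p' : E.sheaf.presheaf.stalk (genericPoint C.X) →ₗ[C.X.functionField]
    D.sheaf.presheaf.stalk (genericPoint C.X) := stalkMap p (genericPoint C.X)
  have hk : LinearMap.ker p' = LinearMap.range i' := by
    ext m
    refine ⟨fun hm => exists_stalkMap_eq_of_exact hS.exact _ m hm, ?_⟩
    rintro ⟨m, rfl⟩
    exact (stalkMap_comp_apply i p _ m).symm.trans (by rw [w]; exact stalkMap_zero_apply _ _)
  have h := LinearMap.finrank_range_add_finrank_ker p'
  rw [hk, LinearMap.finrank_range_of_inj (f := i') hi, LinearMap.range_eq_top.mpr hp, finrank_top,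
    finrank_genericStalk, finrank_genericStalk, finrank_genericStalk] at h
  omega

/-- The frame of A together with lifts of the frame of D. The lifts are chosen in the stalk at x, so
that the generic basis comes from a local one. -/
lemma exists_adapted_basis (hS : (ShortComplex.mk i p w).ShortExact) (x : C.X) :
    ∃ (B : Module.Basis (Fin A.rank ⊕ Fin D.rank) (C.X.presheaf.stalk x)
        (E.sheaf.presheaf.stalk x))
      (β : Module.Basis (Fin A.rank ⊕ Fin D.rank) C.X.functionField
        (E.sheaf.presheaf.stalk (genericPoint C.X))),
      (∀ s, β s = E.sheaf.toGenericStalk x (B s)) ∧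
      (∀ s, β (.inl s) = stalkMap i (genericPoint C.X) (A.genericBasis x s)) ∧
      ∀ t, stalkMap p (genericPoint C.X) (β (.inr t)) = D.genericBasis x t := by
  have := hS.mono_f
  have := hS.epi_g
  have hpi (y : C.X) (m) : stalkMap p y (stalkMap i y m) = 0 := by
    rw [← stalkMap_comp_apply, w, stalkMap_zero_apply]
  choose l hl using fun t => stalkMap_surjective p x (D.stalkBasis x t)
  have hl1 : stalkMap p x ∘ l = D.stalkBasis x := funext hl
  have hl2 (t) : stalkMap p (genericPoint C.X) (E.sheaf.toGenericStalk x (l t)) =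
      D.genericBasis x t := by
    rw [stalkMap_toGenericStalk, hl, genericBasis_apply]
  have hl2' : stalkMap p (genericPoint C.X) ∘ (E.sheaf.toGenericStalk x ∘ l) =
      D.genericBasis x := funext hl2
  let B := Module.Basis.mk
    (linearIndependent_sumElim_of_exact (stalkMap_injective i x) (hpi x)
      (A.stalkBasis x).linearIndependent (hl1 ▸ (D.stalkBasis x).linearIndependent))
    (span_sumElim_eq_top_of_exact (exists_stalkMap_eq_of_exact hS.exact x)
      (A.stalkBasis x).span_eq (hl1 ▸ (D.stalkBasis x).span_eq)).ge
  let β := Module.Basis.mk (R := C.X.functionField)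
    (linearIndependent_sumElim_of_exact (stalkMap_injective i (genericPoint C.X)) (hpi _)
      (A.genericBasis x).linearIndependent (hl2' ▸ (D.genericBasis x).linearIndependent))
    (span_sumElim_eq_top_of_exact (exists_stalkMap_eq_of_exact hS.exact (genericPoint C.X))
      (A.genericBasis x).span_eq (hl2' ▸ (D.genericBasis x).span_eq)).ge
  refine ⟨B, β, ?_, fun s => Module.Basis.mk_apply _ _ _, fun t => ?_⟩
  · rintro (s | s) <;> rw [Module.Basis.mk_apply, Module.Basis.mk_apply]
    · simp only [Sum.elim_inl, Function.comp_apply]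
      rw [genericBasis_apply, stalkMap_toGenericStalk]
    · rfl
  · rw [Module.Basis.mk_apply]
    exact hl2 t

/-- The degree is additive in short exact sequences. -/
theorem degree_eq_add (hS : (ShortComplex.mk i p w).ShortExact) :
    E.degree = A.degree + D.degree := by
  choose B β hβ hβl hβr using exists_adapted_basis hS
  let η := genericPoint C.X
  let e : Fin A.rank ⊕ Fin D.rank ≃ Fin E.rank :=
    finSumFinEquiv.trans (finCongr (rank_eq_add hS).symm)
  -- The discrepancy between the adapted generic basis and the chosen frame of E; it does not depend
  -- on x, so it contributes a principal divisor.
  let c : C.X.functionField := ((β η).reindex e).det (E.genericBasis η)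
  have hdet {ι : Type} [Fintype ι] [DecidableEq ι] {V : Type u} [AddCommGroup V]
      [Module C.X.functionField V] (b b' : Module.Basis ι C.X.functionField V) :
      b.det b' ≠ 0 := (b.isUnit_det b').ne_zero
  have hpi (m) : stalkMap p η (stalkMap i η m) = 0 := by
    rw [← stalkMap_comp_apply, w, stalkMap_zero_apply]
  have key (x : C.X) : C.X.ord (E.detTransition x) x = C.X.ord (A.detTransition x) x +
      C.X.ord (D.detTransition x) x + C.X.ord c x := by
    -- Pass from the frame of E at x to the adapted basis at x, to the adapted basis at η, to the
    -- frame of E at η. The first factor is a unit at x, the second is block triangular.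
    have h1 : E.detTransition x = (E.genericBasis x).det ((β x).reindex e) *
        (A.detTransition x * D.detTransition x) * c := by
      have h2 : ((β x).reindex e).det ((β η).reindex e) =
          A.detTransition x * D.detTransition x := by
        rw [Module.Basis.det_reindex, detTransition_eq_det, detTransition_eq_det]
        rw [← Module.Basis.det_eq_mul_of_exact (i := stalkMap i η) (p := stalkMap p η) hpi
          (hβl x) (hβl η) (hβr x) (hβr η)]
        congr 1
        ext s
        simp
      rw [← h2, detTransition_eq_det, Module.Basis.det_mul_det, Module.Basis.det_mul_det]
    have h3 : C.X.ord ((E.genericBasis x).det ((β x).reindex e)) x = 0 := by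
      convert! E.ord_det_eq_zero x ((B x).reindex e) using 3
      ext s
      simp [hβ]
    have hA : A.detTransition x ≠ 0 := by rw [detTransition_eq_det]; exact hdet _ _
    have hD : D.detTransition x ≠ 0 := by rw [detTransition_eq_det]; exact hdet _ _
    rw [h1, Scheme.ord_mul (mul_ne_zero (hdet _ _) (mul_ne_zero hA hD)) (hdet _ _),
      Scheme.ord_mul (hdet _ _) (mul_ne_zero hA hD), Scheme.ord_mul hA hD, h3, zero_add]
  have hc : c ≠ 0 := hdet _ _
  have h1 := C.finsum_ord_mul_pointDegree c hc
  simp only [degree, key, add_mul]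
  rw [finsum_add_distrib, finsum_add_distrib A.finite_support D.finite_support, h1, add_zero]
  · exact (A.finite_support.union D.finite_support).subset (Function.support_add _ _)
  · exact C.finite_support_ord hc

end ShortExact

end CurveBundle

/-! ### Generic maps and subsheaves. -/

namespace CurveBundle

open Scheme.Modules Limits

variable {k : Type u} [Field k] {C : SmoothProjectiveCurve k} {E F : CurveBundle C}

/-- The map on generic stalks, linear over the function field. -/
noncomputable def genericMap (f : E.sheaf ⟶ F.sheaf) :
    E.sheaf.presheaf.stalk (genericPoint C.X) →ₗ[C.X.functionField]
      F.sheaf.presheaf.stalk (genericPoint C.X) :=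
  stalkMap f (genericPoint C.X)

lemma genericMap_injective (f : E.sheaf ⟶ F.sheaf) [Mono f] :
    Function.Injective (genericMap f) :=
  stalkMap_injective f _

lemma rank_le_of_genericMap_injective {f : E.sheaf ⟶ F.sheaf}
    (hf : Function.Injective (genericMap f)) : E.rank ≤ F.rank := by
  rw [← E.finrank_genericStalk, ← F.finrank_genericStalk]
  exact LinearMap.finrank_le_finrank_of_injective hf

lemma genericMap_injective_iff_surjective {f : E.sheaf ⟶ F.sheaf} (h : E.rank = F.rank) :
    Function.Injective (genericMap f) ↔ Function.Surjective (genericMap f) := by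
  refine LinearMap.injective_iff_surjective_of_finrank_eq_finrank ?_
  rw [E.finrank_genericStalk, F.finrank_genericStalk, h]

/-- Every stalk of a bundle embeds in its generic stalk, so injectivity need only be tested there.
-/
lemma mono_of_genericMap_injective {f : E.sheaf ⟶ F.sheaf}
    (hf : Function.Injective (genericMap f)) : Mono f := by
  refine mono_of_stalkMap_injective f fun x => ?_
  rw [injective_iff_map_eq_zero]
  intro m hm
  apply E.toGenericStalk_injective x
  apply hf
  refine (stalkMap_toGenericStalk f x m).trans ?_
  rw [hm]
  simp

/-- A subsheaf of a vector bundle which is a vector bundle. -/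
structure Sub (E : CurveBundle C) where
  /-- the vector bundle -/
  bundle : CurveBundle C
  /-- the inclusion -/
  ι : bundle.sheaf ⟶ E.sheaf
  mono : Mono ι

/-- The kernel of a morphism. -/
noncomputable def Sub.kernel (f : E.sheaf ⟶ F.sheaf) : Sub E :=
  ⟨kernelBundle f, Limits.kernel.ι f, inferInstanceAs (Mono (Limits.kernel.ι f))⟩

/-- The image of a morphism. -/
noncomputable def Sub.image (f : E.sheaf ⟶ F.sheaf) : Sub F :=
  ⟨imageBundle f, Limits.image.ι f, inferInstanceAs (Mono (Limits.image.ι f))⟩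

/-- The zero subsheaf. -/
noncomputable def Sub.zero (E : CurveBundle C) : Sub E := Sub.kernel (𝟙 E.sheaf)

/-- The whole bundle. -/
def Sub.full (E : CurveBundle C) : Sub E := ⟨E, 𝟙 _, inferInstance⟩

lemma rank_kernel_add_rank_image (f : E.sheaf ⟶ F.sheaf) :
    E.rank = (Sub.kernel f).bundle.rank + (Sub.image f).bundle.rank :=
  rank_eq_add (A := kernelBundle f) (D := imageBundle f) (shortExact_kernel_image f).choose_spec

lemma degree_kernel_add_degree_image (f : E.sheaf ⟶ F.sheaf) :
    E.degree = (Sub.kernel f).bundle.degree + (Sub.image f).bundle.degree :=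
  degree_eq_add (A := kernelBundle f) (D := imageBundle f) (shortExact_kernel_image f).choose_spec

lemma Sub.rank_le (S : Sub E) : S.bundle.rank ≤ E.rank :=
  have := S.mono
  rank_le_of_genericMap_injective (genericMap_injective S.ι)

lemma Sub.ι_zero (E : CurveBundle C) : (Sub.zero E).ι = 0 := by
  have := kernel.condition (𝟙 E.sheaf)
  rwa [Category.comp_id] at this

lemma Sub.rank_zero (E : CurveBundle C) : (Sub.zero E).bundle.rank = 0 := by
  have := (Sub.zero E).mono
  have h := genericMap_injective (Sub.zero E).ι
  rw [← finrank_genericStalk]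
  have h0 (m) : genericMap (Sub.zero E).ι m = 0 := by
    rw [Sub.ι_zero]
    exact stalkMap_zero_apply _ m
  have : Subsingleton ((Sub.zero E).bundle.sheaf.presheaf.stalk (genericPoint C.X)) :=
    ⟨fun a b => h (by rw [h0, h0])⟩
  exact Module.finrank_zero_of_subsingleton

lemma mono_of_rank_kernel {f : E.sheaf ⟶ F.sheaf} (h : (Sub.kernel f).bundle.rank = 0) :
    Mono f := by
  apply mono_of_genericMap_injective
  rw [injective_iff_map_eq_zero]
  intro m hm
  obtain ⟨t, rfl⟩ := exists_stalkMap_eq_of_exact (ShortComplex.exact_kernel f) _ m hm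
  rw [← finrank_genericStalk, Module.finrank_eq_zero_iff_of_free] at h
  have ht : t = 0 := h.elim t 0
  rw [ht, map_zero]

end CurveBundle

/-! ### Semistability tested on kernels and images. -/

namespace BundleChain

open CurveBundle

variable {k : Type u} [Field k] {C : SmoothProjectiveCurve k} {r : ℕ}

/-- The weight `deg E + α rk E` of a bundle at a vertex with parameter `α`. -/
noncomputable def weight (a : ℝ) (E : CurveBundle C) : ℝ := E.degree + E.rank * a

/-- Clearing denominators is legitimate also at vertices of rank 0, because the degree vanishes
there. -/
lemma slope_mul_totalRank (α : Fin (r + 1) → ℝ) (E : BundleChain C r) :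
    slope α E * E.totalRank = ∑ i, weight (α i) (E.E i) := by
  rw [slope, Finset.sum_mul]
  refine Finset.sum_congr rfl fun i _ => ?_
  by_cases hi : (E.E i).rank = 0
  · simp [weight, hi, (E.E i).degree_eq_zero hi]
  · have h1 : ((E.E i).rank : ℝ) ≠ 0 := by exact_mod_cast hi
    have h2 : (E.totalRank : ℝ) ≠ 0 := by
      have : (E.E i).rank ≤ E.totalRank :=
        Finset.single_le_sum (f := fun i => (E.E i).rank) (fun _ _ => zero_le) (Finset.mem_univ i)
      exact_mod_cast (by omega : E.totalRank ≠ 0)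
    rw [weight]
    field_simp

/-- The semistability inequality, in terms of weights, for a family of subbundles preserved by
the maps of the chain. -/
lemma IsSemistable.sum_weight_le {α : Fin (r + 1) → ℝ} {E : BundleChain C r}
    (hE : E.IsSemistable α) (T : ∀ i, Sub (E.E i))
    (hT : ∀ i : Fin r, ∃ ψ : (T i.succ).bundle.sheaf ⟶ (T i.castSucc).bundle.sheaf,
      ψ ≫ (T i.castSucc).ι = (T i.succ).ι ≫ E.φ i) :
    ∑ i, weight (α i) (T i).bundle ≤ (∑ i, ((T i).bundle.rank : ℝ)) * slope α E := by
  choose ψ hψ using hT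
  let E' : BundleChain C r := ⟨fun i => (T i).bundle, ψ⟩
  have h0 : ∑ i, weight (α i) (T i).bundle = slope α E' * E'.totalRank :=
    (slope_mul_totalRank α E').symm
  have h1 : ∑ i, ((T i).bundle.rank : ℝ) = E'.totalRank := by simp [totalRank, E']
  rw [h0, h1, mul_comm]
  by_cases ht : E'.totalRank = 0
  · simp [ht]
  · have := hE E' ⟨fun i => (T i).ι, hψ⟩ (fun i => (T i).mono) ht
    gcongr

lemma IsSemistable.weight_kernel_le {α : Fin (r + 1) → ℝ} {E : BundleChain C r}
    (hE : E.IsSemistable α) (i : Fin r) :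
    weight (α i.succ) (Sub.kernel (E.φ i)).bundle ≤
      (Sub.kernel (E.φ i)).bundle.rank * slope α E := by
  let T : ∀ j, Sub (E.E j) :=
    -- The kernel alone at its vertex; every structure map restricts to zero.
    Function.update (fun j => Sub.zero (E.E j)) i.succ (Sub.kernel (E.φ i))
  have hT (l : Fin r) : (T l.succ).ι ≫ E.φ l = 0 := by
    by_cases h : l = i
    · subst h
      have : T l.succ = Sub.kernel (E.φ l) := Function.update_self _ _ _
      rw [this]
      exact Limits.kernel.condition _
    · have : T l.succ = Sub.zero (E.E l.succ) :=
        Function.update_of_ne (fun h' => h (Fin.succ_injective _ h')) _ _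
      rw [this, Sub.ι_zero, Limits.zero_comp]
  have h := hE.sum_weight_le T fun l => ⟨0, by rw [hT, Limits.zero_comp]⟩
  have hne (j) (hj : j ≠ i.succ) : (T j).bundle.rank = 0 := by
    have : T j = Sub.zero (E.E j) := Function.update_of_ne hj _ _
    rw [this, Sub.rank_zero]
  have hi : T i.succ = Sub.kernel (E.φ i) := Function.update_self _ _ _
  rw [Finset.sum_eq_single_of_mem i.succ (Finset.mem_univ _) (fun j _ hj => by
      simp [weight, hne j hj, (T j).bundle.degree_eq_zero (hne j hj)]),
    Finset.sum_eq_single_of_mem i.succ (Finset.mem_univ _) (fun j _ hj => by simp [hne j hj]),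
    hi] at h
  exact h

lemma IsSemistable.weight_image_le {α : Fin (r + 1) → ℝ} {E : BundleChain C r}
    (hE : E.IsSemistable α) (i : Fin r) :
    weight (α i.castSucc) (Sub.image (E.φ i)).bundle - weight (α i.castSucc) (E.E i.castSucc) ≤
      ((Sub.image (E.φ i)).bundle.rank - (E.E i.castSucc).rank) * slope α E := by
  let T : ∀ j, Sub (E.E j) :=
    -- The full chain with the image at the target of `φ i`; only that map needs to factor, all
    -- others land in a full bundle.
    Function.update (fun j => Sub.full (E.E j)) i.castSucc (Sub.image (E.φ i))
  have hi : T i.castSucc = Sub.image (E.φ i) := Function.update_self _ _ _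
  have hne (j) (hj : j ≠ i.castSucc) : T j = Sub.full (E.E j) := Function.update_of_ne hj _ _
  have h := hE.sum_weight_le T fun l => by
    by_cases h : l = i
    · subst h
      rw [hi]
      exact ⟨(T l.succ).ι ≫ Limits.factorThruImage (E.φ l), (Category.assoc _ _ _).trans
        (congrArg _ (Limits.image.fac _))⟩
    · rw [hne l.castSucc fun h' => h (Fin.castSucc_injective _ h')]
      exact ⟨(T l.succ).ι ≫ E.φ l, Category.comp_id _⟩
  have hsum (f : ∀ j, CurveBundle C → ℝ) : ∑ j, f j (T j).bundle =
      ∑ j, f j (E.E j) + (f i.castSucc (Sub.image (E.φ i)).bundle -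
        f i.castSucc (E.E i.castSucc)) := by
    rw [← Finset.add_sum_erase _ _ (Finset.mem_univ i.castSucc),
      ← Finset.add_sum_erase Finset.univ (fun j => f j (E.E j)) (Finset.mem_univ i.castSucc),
      Finset.sum_congr rfl fun j hj => by rw [hne j (Finset.ne_of_mem_erase hj)], hi]
    simp only [Sub.full]
    ring
  have h1 := slope_mul_totalRank α E
  have h2 : (E.totalRank : ℝ) = ∑ j, ((E.E j).rank : ℝ) := by simp [totalRank]
  rw [hsum (fun j => weight (α j)), hsum (fun _ B => (B.rank : ℝ)), ← h1, ← h2] at h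
  linarith

/-- The inequality given by the kernel and the image of a map of a semistable chain. -/
lemma IsSemistable.exists_defect {α : Fin (r + 1) → ℝ} {E : BundleChain C r}
    (hE : E.IsSemistable α) (i : Fin r) :
    ∃ a b : ℕ, (E.E i.succ).rank + b = (E.E i.castSucc).rank + a ∧ (a = 0 → Mono (E.φ i)) ∧
      ((E.E i.succ).degree : ℝ) - (E.E i.castSucc).degree + a * α i.succ - b * α i.castSucc ≤
        (((E.E i.succ).rank : ℝ) - (E.E i.castSucc).rank) * slope α E := by
  have h1 := hE.weight_kernel_le i
  have h2 := hE.weight_image_le i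
  have h3 := rank_kernel_add_rank_image (E.φ i)
  have h4 := degree_kernel_add_degree_image (E.φ i)
  obtain ⟨b, hb⟩ := Nat.exists_eq_add_of_le (Sub.image (E.φ i)).rank_le
  -- a is the rank of the kernel and b the corank of the image; the bound is the sum of the two
  -- inequalities.
  refine ⟨(Sub.kernel (E.φ i)).bundle.rank, b, by omega, mono_of_rank_kernel, ?_⟩
  simp only [weight] at h1 h2
  rw [hb] at h2 ⊢
  rw [h3, h4]
  push_cast at h2 ⊢
  linarith

end BundleChain

/-! ### Summation along a Harder–Narasimhan flag. -/

/-- Summation by parts: if the partial sums are nonpositive and `μ` is antitone. -/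
lemma Fin.sum_sub_mul_le {h : ℕ} (A : Fin (h + 1 + 1) → ℝ) (μ : Fin (h + 1) → ℝ) (h0 : A 0 = 0)
    (hA : ∀ l, A l ≤ 0) (hμ : Antitone μ) :
    ∑ l, (A l.succ - A l.castSucc) * μ l ≤ A (Fin.last _) * μ (Fin.last _) := by
  induction h with
  | zero => simp [h0]
  | succ h ih =>
    rw [Fin.sum_univ_castSucc]
    have h1 := ih (fun l => A l.castSucc) (fun l => μ l.castSucc) h0 (fun l => hA _)
      fun a b hab => hμ (Fin.castSucc_le_castSucc_iff.mpr hab)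
    have h2 : μ (Fin.last (h + 1)) ≤ μ (Fin.last h).castSucc := hμ (Fin.le_last _)
    have h3 := hA (Fin.last (h + 1)).castSucc
    simp only [Fin.succ_castSucc] at h1 ⊢
    rw [Fin.succ_last]
    nlinarith

lemma Fin.eq_add_sum_of_succ_eq {G : Type*} [AddCommMonoid G] {h : ℕ} (A : Fin (h + 1) → G)
    (g : Fin h → G) (hA : ∀ l, A l.succ = A l.castSucc + g l) :
    A (Fin.last h) = A 0 + ∑ l, g l := by
  induction h with
  | zero => simp
  | succ h ih =>
    have h1 := ih (fun l => A l.castSucc) (fun l => g l.castSucc) fun l => hA l.castSucc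
    rw [Fin.sum_univ_castSucc, ← add_assoc, ← Fin.succ_last, hA]
    exact congrArg (· + _) h1

namespace BundleChain

open CurveBundle Scheme.Modules

variable {k : Type u} [Field k] {C : SmoothProjectiveCurve k} {r : ℕ} {α : Fin (r + 1) → ℝ}
  {E : BundleChain C r}

namespace HNFlag

variable (flag : E.HNFlag α)

/-- Descend from the top of the flag: each step is a subchain of the next, and restricting an
injective map keeps it injective. -/
lemma genericMap_injective (hE : ∀ i : Fin r, Function.Injective (genericMap (E.φ i)))
    (l : Fin (flag.h + 1)) :
    ∀ i : Fin r, Function.Injective (genericMap ((flag.F l).φ i)) := by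
  induction l using Fin.reverseInduction with
  | last => rw [flag.top_eq]; exact hE
  | cast l ih =>
    intro i
    obtain ⟨w, hS⟩ := flag.shortExact l i.succ
    have : Mono ((flag.incl l).app i.succ) := hS.mono_f
    have h1 := (ih i).comp (CurveBundle.genericMap_injective ((flag.incl l).app i.succ))
    have h2 : genericMap ((flag.F l.succ).φ i) ∘ genericMap ((flag.incl l).app i.succ) =
        genericMap ((flag.incl l).app i.castSucc) ∘ genericMap ((flag.F l.castSucc).φ i) := by
      ext m
      simp only [Function.comp_apply, genericMap]
      rw [← stalkMap_comp_apply, ← stalkMap_comp_apply, (flag.incl l).comm]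
    rw [h2] at h1
    exact h1.of_comp

lemma rank_F_zero (i : Fin (r + 1)) : ((flag.F 0).E i).rank = 0 :=
  Finset.sum_eq_zero_iff.mp flag.bot_eq i (Finset.mem_univ i)

lemma rank_F_succ (l : Fin flag.h) (i : Fin (r + 1)) :
    ((flag.F l.succ).E i).rank = ((flag.F l.castSucc).E i).rank + ((flag.G l).E i).rank :=
  rank_eq_add (flag.shortExact l i).choose_spec

lemma sum_rank (i : Fin (r + 1)) : ∑ l, ((flag.G l).E i).rank = (E.E i).rank := by
  have h := Fin.eq_add_sum_of_succ_eq (fun l => ((flag.F l).E i).rank) _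
    (flag.rank_F_succ · i)
  rw [flag.top_eq, flag.rank_F_zero, zero_add] at h
  exact h.symm

lemma sum_degree (i : Fin (r + 1)) : ∑ l, ((flag.G l).E i).degree = (E.E i).degree := by
  have h := Fin.eq_add_sum_of_succ_eq (fun l => ((flag.F l).E i).degree)
    (fun l => ((flag.G l).E i).degree) fun l => degree_eq_add (flag.shortExact l i).choose_spec
  rw [flag.top_eq, degree_eq_zero _ (flag.rank_F_zero i), zero_add] at h
  exact h.symm

/-- The partial sums of the rank differences are those of the steps of the flag: nonpositive by
generic injectivity, and zero at the top. The slopes decrease. -/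
lemma sum_rank_sub_mul_slope_le (hE : ∀ i : Fin r, Function.Injective (genericMap (E.φ i)))
    (i : Fin r) (hr : (E.E i.succ).rank = (E.E i.castSucc).rank) :
    ∑ l, ((((flag.G l).E i.succ).rank : ℝ) - ((flag.G l).E i.castSucc).rank) *
      slope α (flag.G l) ≤ 0 := by
  -- Summation by parts refers to a last slope, so the flag of length zero is treated apart.
  obtain ⟨h, F, G, incl, proj, se, bot, top, ne, ss, anti⟩ := flag
  cases h with
  | zero => simp
  | succ h =>
    let flag : E.HNFlag α := ⟨h + 1, F, G, incl, proj, se, bot, top, ne, ss, anti⟩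
    have key := Fin.sum_sub_mul_le
      (fun l => (((F l).E i.succ).rank : ℝ) - ((F l).E i.castSucc).rank)
      (fun l => slope α (G l)) (by
        have h1 := flag.rank_F_zero i.succ
        have h2 := flag.rank_F_zero i.castSucc
        simp only [flag] at h1 h2
        simp [h1, h2])
      (fun l => sub_nonpos.mpr (by
        exact_mod_cast rank_le_of_genericMap_injective (flag.genericMap_injective hE l i)))
      anti.antitone
    have htop : (((F (Fin.last (h + 1))).E i.succ).rank : ℝ) -
        ((F (Fin.last (h + 1))).E i.castSucc).rank = 0 := by
      rw [top, hr, sub_self]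
    rw [htop, zero_mul] at key
    refine le_of_eq_of_le (Finset.sum_congr rfl fun l _ => ?_) key
    have h1 := flag.rank_F_succ l i.succ
    have h2 := flag.rank_F_succ l i.castSucc
    simp only [flag] at h1 h2
    simp only [h1, h2]
    push_cast
    ring

end HNFlag

end BundleChain

/-! ### The numerical conclusion. -/

lemma eq_zero_of_mul_le_of_lt {m : ℕ} {a d : ℝ} (hd : 0 ≤ d) (h : d < a) (hm : m * a ≤ d) :
    m = 0 := by
  by_contra h0
  have h1 : (1 : ℝ) ≤ m := by exact_mod_cast Nat.one_le_iff_ne_zero.mpr h0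
  nlinarith

theorem proposition6p5 {k : Type u} [Field k] (C : SmoothProjectiveCurve k) (n r : ℕ)
    (d : Fin (r + 1) → ℤ) (α : Fin (r + 1) → ℝ)
    (hd : ∀ i : Fin r, d i.succ ≤ d i.castSucc)
    (hα : ∀ i : Fin r, (d i.castSucc : ℝ) - (d i.succ : ℝ) < α i.succ - α i.castSucc)
    (E : BundleChain C r) (hrank : ∀ i, (E.E i).rank = n) (hdeg : ∀ i, (E.E i).degree = d i) :
    (E.IsSemistable α → ∀ i : Fin r, Mono (E.φ i) ∧ GenericallySurjective (E.φ i)) ∧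
    ((∀ i : Fin r, GenericallySurjective (E.φ i)) →
      ∀ (flag : E.HNFlag α) (j : Fin flag.h), ∃ m : ℕ, ∀ i, ((flag.G j).E i).rank = m) := by
  have hd' (i : Fin r) : (0 : ℝ) ≤ (d i.castSucc : ℝ) - d i.succ :=
    sub_nonneg.mpr (by exact_mod_cast hd i)
  have hr (i : Fin r) : (E.E i.succ).rank = (E.E i.castSucc).rank := by rw [hrank, hrank]
  constructor
  · intro hE i
    obtain ⟨a, b, hab, hmono, hle⟩ := hE.exists_defect i
    have hab' : b = a := by have := hr i; omega
    rw [hab', hr i, sub_self, zero_mul, hdeg, hdeg] at hle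
    have := hmono (eq_zero_of_mul_le_of_lt (hd' i) (hα i) (by linarith))
    exact ⟨this, (CurveBundle.genericMap_injective_iff_surjective (hr i)).mp
      (CurveBundle.genericMap_injective _)⟩
  · intro hsurj flag
    have hinj (i : Fin r) : Function.Injective (CurveBundle.genericMap (E.φ i)) :=
      (CurveBundle.genericMap_injective_iff_surjective (hr i)).mpr (hsurj i)
    have step (i : Fin r) (j : Fin flag.h) :
        ((flag.G j).E i.succ).rank = ((flag.G j).E i.castSucc).rank := by
      choose a b hab _ hle using fun l => (flag.semistable l).exists_defect i
      have h1 := (Finset.sum_le_sum fun l (_ : l ∈ Finset.univ) => hle l).trans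
        (flag.sum_rank_sub_mul_slope_le hinj i (hr i))
      -- Single subquotients may have different ranks at the two vertices; only the totals of a and
      -- b must agree.
      have h2 : ∑ l, b l = ∑ l, a l := by
        have := Finset.sum_congr rfl fun l (_ : l ∈ Finset.univ) => hab l
        rw [Finset.sum_add_distrib, Finset.sum_add_distrib, flag.sum_rank, flag.sum_rank,
          hr i] at this
        omega
      have h3 := congrArg (Int.cast : ℤ → ℝ) (flag.sum_degree i.succ)
      have h4 := congrArg (Int.cast : ℤ → ℝ) (flag.sum_degree i.castSucc)
      have h5 := congrArg (Nat.cast : ℕ → ℝ) h2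
      push_cast at h3 h4 h5
      simp only [Finset.sum_add_distrib, Finset.sum_sub_distrib, ← Finset.sum_mul] at h1
      rw [h3, h4, h5, hdeg, hdeg] at h1
      -- The argument of the first claim, applied to the total; as the terms are natural numbers,
      -- each one vanishes.
      have h6 : ∑ l, a l = 0 := eq_zero_of_mul_le_of_lt (hd' i) (hα i) (by push_cast; linarith)
      have h7 := Finset.sum_eq_zero_iff.mp h6 j (Finset.mem_univ j)
      have h8 := Finset.sum_eq_zero_iff.mp (h2.trans h6) j (Finset.mem_univ j)
      have := hab j
      omega
    intro j
    refine ⟨((flag.G j).E 0).rank, fun i => ?_⟩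
    induction i using Fin.induction with
    | zero => rfl
    | succ i ih => rw [step i j, ih]
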